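/- **Setting.** Let $M=\langle S,A,P,\mu,\mathbf r,\gamma\rangle$ be a multi-objective Markov decision process with finite state space $S$, finite nonempty action space $A$, transition probabilities $P(\cdot\mid s,a)$, initial distribution $\mu$, reward $\mathbf r=(r_1,\dots,r_K):S\times A\to\mathbb R^K$ ($K\ge1$) and discount factor $\gamma\in(0,1)$. Assume that every state is reachable from $\mu$, i.e. is visited with positive probability from the initial distribution $\mu$ under some choice of actions. For $\theta\in\mathbb R^{S\times A}$ let $\pi_\theta(a|s)=e^{\theta_{sa}}/\sum_{a'}e^{\theta_{sa'}}$. For a policy $\pi$ put $$V_k^\pi=\mathbb E_{\mu,\pi}\Big[\sum_{t\ge0}\gamma^t r_k(s_t,a_t)\Big],\quad \tilde H(\pi)=\mathbb E_{\mu,\pi}\Big[-\sum_{t\ge0}\gamma^t\log\pi(a_t|s_t)\Big],\quad V^\pi_{k,\tau}=V^\pi_k+\tau\tilde H(\pi),$$ and for a weight vector $w\in\Delta^K$ (the probability simplex) let $$Q^\pi_{w,\tau}(s,a)=\langle w,\mathbf r(s,a)\rangle+\gamma\,\mathbb E_{s'\sim P(\cdot|s,a)}\big[V^\pi_{w,\tau}(s')\big],\qquad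 V^\pi_{w,\tau}(s')=\mathbb E_{s_0=s',\pi}\Big[\sum_{t\ge0}\gamma^t\big(\langle w,\mathbf r(s_t,a_t)\rangle-\tau\log\pi(a_t|s_t)\big)\Big].$$ For $\tau,\tau_w>0$ the regularized game is the two-player zero-sum game in which the learner chooses $\theta\in\mathbb R^{S\times A}$ to maximize, and the adversary chooses $w\in\Delta^K$ to minimize, $$u(\theta,w)=\sum_k w(k)V_k^{\pi_\theta}+\tau\tilde H(\pi_\theta)-\tau_wH(w),\qquad H(w)=-\sum_k w(k)\log w(k).$$ **Algorithm (ERAM with exact policy evaluation).** From $\theta_0\in\mathbb R^{S\times A}$ and $w_0\in\Delta^K$ with all entries positive, with step sizes $\eta,\lambda$ and $\beta=\frac1{\lambda\tau_w+1}$, iterate for $t\ge0$ $$\theta_{t+1}=\theta_t+\eta\,F(\theta_t)^\dagger\sum_{k=1}^K w_t(k)\nabla_\theta V^{\pi_{\theta_t}}_{k,\tau},\qquad w_{t+1}=\operatorname{softmax}\Big(-\frac{1-\beta}{\tau_w}\mathbf V^{\pi_{\theta_t}}+\beta\log w_t\Big),$$ where $F(\theta)=\mathbb E_{(s,a)\sim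 d^{\pi_\theta}}[\nabla_\theta\log\pi_\theta(a|s)\nabla_\theta\log\pi_\theta(a|s)^{T}]$, $d^{\pi}(s,a)=(1-\gamma)\sum_{t\ge0}\gamma^t\Pr_{\mu,\pi}(s_t=s)\,\pi(a|s)$, and $\dagger$ is the Moore–Penrose pseudo-inverse. Write $\pi_t=\pi_{\theta_t}$. **Theorem.** For every $\gamma\in(0,1)$ there is $\epsilon_0\in(0,1]$, depending only on $\gamma$, such that the following holds for every $M$ as above with discount factor $\gamma$ and all $\tau,\tau_w>0$ with $$\tau_w\ \ge\ \frac{12K\big(\max_{s,a,k}|r_k(s,a)|+\tau\log|A|\big)^2}{\tau(1-\gamma)^4}.$$ The regularized game has a Nash equilibrium. Moreover, for every $\epsilon\in(0,\epsilon_0)$, with $\eta=\frac{\epsilon(1-\gamma)}{\tau}$ and $\lambda=\frac{\epsilon^2}{\tau_w(1-\epsilon^2)}$, there is $\rho=\rho(\eta,\lambda)$ with $0<\rho\le1-\frac{\epsilon^2}{2}<1$ such that, for every Nash equilibrium $(\theta^*,w^*)$, with $\pi^*=\pi_{\theta^*}$, and every initialization $(\theta_0,w_0)$, there are constants $C_1,C_2,C_3$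 such that for all $t\ge0$ $$\|\log\pi^*-\log\pi_t\|_\infty\le C_1\rho^t,\qquad \|w^*-w_t\|_\infty\le C_2\rho^t,\qquad \|Q^{\pi^*}_{w^*,\tau}-Q^{\pi_t}_{w_t,\tau}\|_\infty\le C_3\rho^t.$$ -/

import Mathlib

open scoped Matrix

/-! ### Moore–Penrose pseudo-inverse of a real matrix -/

/-- The four Penrose equations. -/
structure IsMoorePenrose {m n : Type*} [Fintype m] [Fintype n]
    (A : Matrix m n ℝ) (B : Matrix n m ℝ) : Prop where
  mul_mul_self : A * B * A = A
  mul_mul_inv : B * A * B = B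
  symm_left : (A * B)ᵀ = A * B
  symm_right : (B * A)ᵀ = B * A

theorem exists_isMoorePenrose_of_symm {n : Type*} [Fintype n] (H : Matrix n n ℝ) (hH : Hᵀ = H) :
    ∃ B : Matrix n n ℝ, Bᵀ = B ∧ IsMoorePenrose H B := by
  classical
  have hh : H.IsHermitian := by
    rw [Matrix.IsHermitian, Matrix.conjTranspose_eq_transpose_of_trivial, hH]
  obtain ⟨U, d, hU, hHd⟩ : ∃ (U : Matrix n n ℝ) (d : n → ℝ),
      Uᵀ * U = 1 ∧ H = U * Matrix.diagonal d * Uᵀ := by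
    refine ⟨hh.eigenvectorUnitary, hh.eigenvalues, ?_, ?_⟩
    · have := Unitary.coe_star_mul_self hh.eigenvectorUnitary
      simpa [Matrix.star_eq_conjTranspose, Matrix.conjTranspose_eq_transpose_of_trivial] using this
    · have := hh.spectral_theorem
      simpa [Unitary.conjStarAlgAut_apply, Matrix.star_eq_conjTranspose,
        Matrix.conjTranspose_eq_transpose_of_trivial, Function.comp_def] using this
  have key : ∀ a b : n → ℝ, (U * Matrix.diagonal a * Uᵀ) * (U * Matrix.diagonal b * Uᵀ)
      = U * Matrix.diagonal (fun i => a i * b i) * Uᵀ := by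
    intro a b
    rw [← Matrix.diagonal_mul_diagonal]
    calc _ = U * Matrix.diagonal a * (Uᵀ * U) * Matrix.diagonal b * Uᵀ := by
            simp only [Matrix.mul_assoc]
      _ = _ := by rw [hU]; simp only [Matrix.mul_assoc, Matrix.mul_one]
  have ksym : ∀ a : n → ℝ, (U * Matrix.diagonal a * Uᵀ)ᵀ = U * Matrix.diagonal a * Uᵀ := by
    intro a
    simp [Matrix.transpose_mul, Matrix.mul_assoc]
  refine ⟨U * Matrix.diagonal (fun i => (d i)⁻¹) * Uᵀ, ksym _, ?_, ?_, ?_, ?_⟩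
  · rw [hHd, key, key]
    have e : (fun i => d i * (d i)⁻¹ * d i) = d := by
      funext i; exact mul_inv_mul_cancel (d i)
    rw [e]
  · rw [hHd, key, key]
    have e : (fun i => (d i)⁻¹ * d i * (d i)⁻¹) = fun i => (d i)⁻¹ := by
      funext i; simpa using mul_inv_mul_cancel (d i)⁻¹
    rw [e]
  · rw [hHd, key, ksym]
  · rw [hHd, key, ksym]

theorem exists_isMoorePenrose {m n : Type*} [Fintype m] [Fintype n] (A : Matrix m n ℝ) :
    ∃ B : Matrix n m ℝ, IsMoorePenrose A B := by
  obtain ⟨B, hB, h1, h2, h3, h4⟩ :=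
    exists_isMoorePenrose_of_symm (Aᵀ * A) (by simp [Matrix.transpose_mul])
  have hA : A * B * (Aᵀ * A) = A := by
    have h0 : (A * B * (Aᵀ * A) - A)ᴴ * (A * B * (Aᵀ * A) - A) = 0 := by
      rw [Matrix.conjTranspose_eq_transpose_of_trivial, Matrix.transpose_sub]
      have e : (A * B * (Aᵀ * A))ᵀ = Aᵀ * A * B * Aᵀ := by
        simp [Matrix.transpose_mul, hB, Matrix.mul_assoc]
      rw [e, Matrix.sub_mul, Matrix.mul_sub, Matrix.mul_sub]
      have e1 : Aᵀ * A * B * Aᵀ * (A * B * (Aᵀ * A)) = Aᵀ * A := by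
        calc _ = Aᵀ * A * B * (Aᵀ * A) * B * (Aᵀ * A) := by simp only [Matrix.mul_assoc]
          _ = _ := by rw [h1, h1]
      have e2 : Aᵀ * A * B * Aᵀ * A = Aᵀ * A := by
        calc _ = Aᵀ * A * B * (Aᵀ * A) := by simp only [Matrix.mul_assoc]
          _ = _ := h1
      have e3 : Aᵀ * (A * B * (Aᵀ * A)) = Aᵀ * A := by
        calc _ = Aᵀ * A * B * (Aᵀ * A) := by simp only [Matrix.mul_assoc]
          _ = _ := h1
      rw [e1, e2, e3]; simp
    exact sub_eq_zero.mp (Matrix.conjTranspose_mul_self_eq_zero.mp h0)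
  refine ⟨B * Aᵀ, ?_, ?_, ?_, ?_⟩
  · simpa only [Matrix.mul_assoc] using hA
  · calc _ = B * (Aᵀ * A) * B * Aᵀ := by simp only [Matrix.mul_assoc]
      _ = _ := by rw [h2]
  · simp [Matrix.transpose_mul, hB, Matrix.mul_assoc]
  · rw [Matrix.mul_assoc]; exact h4

/-- The Moore–Penrose pseudo-inverse `A†`: the (unique) solution of the Penrose equations. -/
noncomputable def moorePenrose {m n : Type*} [Fintype m] [Fintype n] (A : Matrix m n ℝ) :
    Matrix n m ℝ :=
  (exists_isMoorePenrose A).choose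

theorem moorePenrose_spec {m n : Type*} [Fintype m] [Fintype n] (A : Matrix m n ℝ) :
    IsMoorePenrose A (moorePenrose A) :=
  (exists_isMoorePenrose A).choose_spec

/-! ### Softmax -/

noncomputable def softmax {ι : Type*} [Fintype ι] (x : ι → ℝ) : ι → ℝ :=
  fun i => Real.exp (x i) / ∑ j, Real.exp (x j)

/-- The tabular softmax policy `π_θ(a|s)`. -/
noncomputable def softmaxPolicy {S A : Type*} [Fintype A] (θ : S × A → ℝ) : S → A → ℝ :=
  fun s => softmax fun a => θ (s, a)

/-- The Shannon entropy `H(w)` (with `0 log 0 = 0`). -/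
noncomputable def shannonEntropy {K : ℕ} (w : Fin K → ℝ) : ℝ :=
  -∑ k, w k * Real.log (w k)

/-- The vector of partial derivatives of `f` at `θ`. -/
noncomputable def gradVec {ι : Type*} [Fintype ι] [DecidableEq ι]
    (f : (ι → ℝ) → ℝ) (θ : ι → ℝ) : ι → ℝ :=
  fun i => fderiv ℝ f θ (Pi.single i 1)

/-! ### Multi-objective Markov decision processes -/

/-- A tabular multi-objective MDP `⟨S, A, P, μ, r, γ⟩` with `K` objectives. -/
structure MOMDP (S A : Type*) [Fintype S] (K : ℕ) where
  P : S → A → S → ℝ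
  P_mem : ∀ s a, P s a ∈ stdSimplex ℝ S
  μ : S → ℝ
  μ_mem : μ ∈ stdSimplex ℝ S
  r : S → A → Fin K → ℝ
  γ : ℝ
  γ_pos : 0 < γ
  γ_lt_one : γ < 1

namespace MOMDP

variable {S A : Type*} [Fintype S] [Fintype A] {K : ℕ} (M : MOMDP S A K)

/-- States visited with positive probability, starting from `μ`, under some choice of actions. -/
inductive Reachable : S → Prop
  | init (s : S) (h : 0 < M.μ s) : Reachable s
  | step (s : S) (a : A) (s' : S) (hs : Reachable s) (h : 0 < M.P s a s') : Reachable s'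

/-- The law of the state `s_t` when `s_0 ∼ ν` and the actions are drawn from `π`. -/
def stateDist (π : S → A → ℝ) (ν : S → ℝ) : ℕ → S → ℝ
  | 0 => ν
  | t + 1 => fun s' => ∑ s, ∑ a, stateDist π ν t s * π s a * M.P s a s'

/-- `𝔼_{ν,π}[∑_t γ^t f(s_t, a_t)]`. -/
noncomputable def discounted (π : S → A → ℝ) (ν : S → ℝ) (f : S → A → ℝ) : ℝ :=
  ∑' t : ℕ, M.γ ^ t * ∑ s, ∑ a, M.stateDist π ν t s * π s a * f s a

/-- The value `V_k^π` (initial law `μ`). -/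
noncomputable def value (π : S → A → ℝ) (k : Fin K) : ℝ :=
  M.discounted π M.μ fun s a => M.r s a k

/-- The discounted policy entropy `H̃(π)`. -/
noncomputable def policyEntropy (π : S → A → ℝ) : ℝ :=
  M.discounted π M.μ fun s a => -Real.log (π s a)

/-- The soft value `V_{k,τ}^π`, with initial law `ν`. -/
noncomputable def softValue (τ : ℝ) (π : S → A → ℝ) (ν : S → ℝ) (k : Fin K) : ℝ :=
  M.discounted π ν fun s a => M.r s a k - τ * Real.log (π s a)

/-- The soft action value
`Q_{w,τ}^π(s,a) = ⟨w, r(s,a)⟩ + γ 𝔼_{s' ∼ P(·|s,a)}[V_{w,τ}^π(s')]`. -/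
noncomputable def softQ [DecidableEq S] (τ : ℝ) (π : S → A → ℝ) (w : Fin K → ℝ) :
    S → A → ℝ :=
  fun s a => ∑ k, w k * M.r s a k +
    M.γ * ∑ s', M.P s a s' * ∑ k, w k * M.softValue τ π (Pi.single s' 1) k

/-- The discounted state visitation distribution `d^π`, with initial law `μ`. -/
noncomputable def visitation (π : S → A → ℝ) (s : S) : ℝ :=
  (1 - M.γ) * ∑' t : ℕ, M.γ ^ t * M.stateDist π M.μ t s

/-- The Fisher information matrix
`F(θ) = 𝔼_{(s,a) ∼ d^{π_θ}}[∇_θ log π_θ(a|s) ∇_θ log π_θ(a|s)ᵀ]`. -/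
noncomputable def fisher [DecidableEq S] [DecidableEq A] (θ : S × A → ℝ) :
    Matrix (S × A) (S × A) ℝ :=
  ∑ s, ∑ a, (M.visitation (softmaxPolicy θ) s * softmaxPolicy θ s a) •
    Matrix.vecMulVec (gradVec (fun θ' => Real.log (softmaxPolicy θ' s a)) θ)
      (gradVec (fun θ' => Real.log (softmaxPolicy θ' s a)) θ)

/-! ### The regularized game -/

/-- The learner's utility in the regularized game; the adversary's is its negative. -/
noncomputable def utility (τ τw : ℝ) (θ : S × A → ℝ) (w : Fin K → ℝ) : ℝ :=
  ∑ k, w k * M.value (softmaxPolicy θ) k + τ * M.policyEntropy (softmaxPolicy θ)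
    - τw * shannonEntropy w

/-- `(θ, w)` is a Nash equilibrium of the regularized game. -/
structure IsNash (τ τw : ℝ) (θ : S × A → ℝ) (w : Fin K → ℝ) : Prop where
  mem : w ∈ stdSimplex ℝ (Fin K)
  learner : ∀ θ', M.utility τ τw θ' w ≤ M.utility τ τw θ w
  adversary : ∀ w' ∈ stdSimplex ℝ (Fin K), -M.utility τ τw θ w' ≤ -M.utility τ τw θ w

/-! ### ERAM with exact policy evaluation -/

/-- Natural policy gradient step with step size `η`:
`θ + η F(θ)† ∑_k w(k) ∇_θ V_{k,τ}^{π_θ}`. -/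
noncomputable def npgStep [DecidableEq S] [DecidableEq A] (η τ : ℝ)
    (θ : S × A → ℝ) (w : Fin K → ℝ) : S × A → ℝ :=
  θ + η • (moorePenrose (M.fisher θ) *ᵥ
    ∑ k, w k • gradVec (fun θ' => M.softValue τ (softmaxPolicy θ') M.μ k) θ)

/-- Mirror-descent step with step size `lam`:
`softmax(-(1-β)/τ_w V^{π_θ} + β log w)`, where `β = 1/(lam τ_w + 1)`. -/
noncomputable def weightStep (lam τw : ℝ) (θ : S × A → ℝ) (w : Fin K → ℝ) : Fin K → ℝ :=
  let β := 1 / (lam * τw + 1)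
  softmax fun k => -((1 - β) / τw) * M.value (softmaxPolicy θ) k + β * Real.log (w k)

/-- The iterates `(θ_t, w_t)` of ERAM started at `(θ₀, w₀)`. -/
noncomputable def eram [DecidableEq S] [DecidableEq A] (η lam τ τw : ℝ)
    (θ₀ : S × A → ℝ) (w₀ : Fin K → ℝ) : ℕ → (S × A → ℝ) × (Fin K → ℝ)
  | 0 => (θ₀, w₀)
  | t + 1 =>
    let p := eram η lam τ τw θ₀ w₀ t
    (M.npgStep η τ p.1 p.2, M.weightStep lam τw p.1 p.2)

end MOMDP

/-! ### Softmax and log-sum-exp -/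

/-! In logit coordinates both updates are averages. The Fisher matrix splits into one block per
state whose kernel is the constants in the action, so the natural gradient step changes the logits,
modulo a function of the state, to `(1 - ε) ξ + ε Q / τ`: soft policy iteration damped by `ε`
(`exists_npgStep_eq`). The mirror step changes the weight logits to `(1 - ε²) ζ - ε² V / τ_w`.
Softmax ignores additive constants, so representatives `ξ`, `ζ` that obey these recursions exactly
may be tracked.

A Nash equilibrium is a mutual best response, and by the Gibbs variational principle each best
response is a softmax: the policy is the softmax of its own soft Q-function over `τ`, so that this
Q-function solves the soft Bellman optimality equation, and the weights are the softmax of `-V /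
τ_w`. Conversely, a fixed point of these two maps is an equilibrium, and the lower bound on `τ_w`
makes their combination a contraction in a suitably scaled sup norm. This gives existence.

For convergence three errors are followed: `x` for `|Q⋆ - τ ξ|`, `m` for the one-sided gap `τ ξ -
Q^π`, and `q` for the weight logits. The gap `|Q⋆ - Q^π|` is at most `γ (x + m)` plus a multiple of
`q` (`ErrorBound.abs_sub_softQ_le`). The gap `m` shrinks by `1 - ε` up to the change of reward,
since a damped step improves the policy (`softQScalar_sub_le_of_interpolation`). The error `q`
shrinks by `1 - ε²` up to `ε²` times a multiple of `x`, since returns are Lipschitz in the logits.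
The weights move on the slower scale `ε²`, so their drift is negligible against the decay of `m`.
Weak coupling then lets one choose constants for which all three errors decay like `(1 - ε²/2)^t`
(`exists_errorBound_eram`). -/

/-- `log ∑ exp x_i`. -/
noncomputable def logSumExp {ι : Type*} [Fintype ι] (x : ι → ℝ) : ℝ :=
  Real.log (∑ i, Real.exp (x i))

section Softmax

variable {ι : Type*} [Fintype ι] [Nonempty ι]

theorem sum_exp_pos (x : ι → ℝ) : 0 < ∑ i, Real.exp (x i) :=
  Finset.sum_pos (fun _ _ => Real.exp_pos _) Finset.univ_nonempty

theorem softmax_pos (x : ι → ℝ) (i : ι) : 0 < softmax x i :=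
  div_pos (Real.exp_pos _) (sum_exp_pos x)

theorem sum_softmax (x : ι → ℝ) : ∑ i, softmax x i = 1 := by
  simp only [softmax]
  rw [← Finset.sum_div, div_self (sum_exp_pos x).ne']

theorem softmax_mem (x : ι → ℝ) : softmax x ∈ stdSimplex ℝ ι :=
  ⟨fun i => (softmax_pos x i).le, sum_softmax x⟩

theorem log_softmax (x : ι → ℝ) (i : ι) : Real.log (softmax x i) = x i - logSumExp x := by
  rw [softmax, Real.log_div (Real.exp_pos _).ne' (sum_exp_pos x).ne', Real.log_exp, logSumExp]

theorem softmax_eq_exp (x : ι → ℝ) (i : ι) : softmax x i = Real.exp (x i - logSumExp x) := by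
  rw [← log_softmax, Real.exp_log (softmax_pos x i)]

theorem logSumExp_add_const (x : ι → ℝ) (c : ℝ) :
    logSumExp (fun i => x i + c) = logSumExp x + c := by
  simp only [logSumExp, Real.exp_add]
  rw [← Finset.sum_mul, Real.log_mul (sum_exp_pos x).ne' (Real.exp_pos _).ne', Real.log_exp]

/-- This gauge invariance absorbs the unknown state function in the natural gradient step and the
normalizers in both updates. -/
theorem softmax_eq_of_sub_const {x y : ι → ℝ} (c : ℝ) (h : ∀ i, x i = y i + c) :
    softmax x = softmax y := by
  obtain rfl : x = fun i => y i + c := funext h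
  funext i
  rw [softmax_eq_exp, softmax_eq_exp, logSumExp_add_const]
  congr 1; ring

theorem logSumExp_le {x y : ι → ℝ} {c : ℝ} (h : ∀ i, x i ≤ y i + c) :
    logSumExp x ≤ logSumExp y + c := by
  rw [← logSumExp_add_const]
  exact Real.log_le_log (sum_exp_pos x) (Finset.sum_le_sum fun i _ => Real.exp_le_exp.2 (h i))

/-- Log-sum-exp is monotone and commutes with adding constants, hence is nonexpansive in the sup
norm. -/
theorem abs_logSumExp_sub_le {x y : ι → ℝ} {c : ℝ} (h : ∀ i, |x i - y i| ≤ c) :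
    |logSumExp x - logSumExp y| ≤ c := by
  rw [abs_le]
  constructor
  · have := logSumExp_le (x := y) (y := x) (c := c) fun i => by linarith [(abs_le.1 (h i)).1]
    linarith
  · have := logSumExp_le (x := x) (y := y) (c := c) fun i => by linarith [(abs_le.1 (h i)).2]
    linarith

theorem abs_log_softmax_sub_le {x y : ι → ℝ} {c : ℝ} (h : ∀ i, |x i - y i| ≤ c) (i : ι) :
    |Real.log (softmax x i) - Real.log (softmax y i)| ≤ 2 * c := by
  rw [log_softmax, log_softmax]
  have h1 := abs_le.1 (h i)
  have h2 := abs_le.1 (abs_logSumExp_sub_le h)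
  rw [abs_le]
  constructor <;> linarith

/-- The gap in the Gibbs variational principle, as a sum of nonnegative terms. -/
theorem logSumExp_sub_eq_sum_klFun (y p : ι → ℝ) (h1 : ∑ i, p i = 1) :
    logSumExp y - ∑ i, p i * (y i - Real.log (p i)) =
      ∑ i, softmax y i * InformationTheory.klFun (p i / softmax y i) := by
  have key : ∀ i, softmax y i * InformationTheory.klFun (p i / softmax y i) =
      logSumExp y * p i - p i * (y i - Real.log (p i)) + (softmax y i - p i) := by
    intro i
    have hs := softmax_pos y i
    by_cases hp : p i = 0
    · simp [hp, InformationTheory.klFun]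
    · rw [InformationTheory.klFun, Real.log_div hp hs.ne', log_softmax]
      field_simp
      ring
  simp_rw [key]
  rw [Finset.sum_add_distrib, Finset.sum_sub_distrib, Finset.sum_sub_distrib, ← Finset.mul_sum,
    h1, sum_softmax]
  ring

/-- The Gibbs variational inequality. -/
theorem sum_mul_sub_log_le_logSumExp (y : ι → ℝ) {p : ι → ℝ} (hp : p ∈ stdSimplex ℝ ι) :
    ∑ i, p i * (y i - Real.log (p i)) ≤ logSumExp y := by
  have h := logSumExp_sub_eq_sum_klFun y p hp.2
  have : 0 ≤ ∑ i, softmax y i * InformationTheory.klFun (p i / softmax y i) :=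
    Finset.sum_nonneg fun i _ => mul_nonneg (softmax_pos y i).le
      (InformationTheory.klFun_nonneg (div_nonneg (hp.1 i) (softmax_pos y i).le))
  linarith

theorem sum_softmax_mul_sub_log (y : ι → ℝ) :
    ∑ i, softmax y i * (y i - Real.log (softmax y i)) = logSumExp y := by
  simp_rw [log_softmax, sub_sub_cancel]
  rw [← Finset.sum_mul, sum_softmax, one_mul]

/-- Softmax is the unique maximizer in the Gibbs variational principle. -/
theorem eq_softmax_of_logSumExp_le {y p : ι → ℝ} (hp : p ∈ stdSimplex ℝ ι)
    (h : logSumExp y ≤ ∑ i, p i * (y i - Real.log (p i))) : p = softmax y := by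
  have h0 := logSumExp_sub_eq_sum_klFun y p hp.2
  have hn : ∀ i ∈ Finset.univ,
      0 ≤ softmax y i * InformationTheory.klFun (p i / softmax y i) :=
    fun i _ => mul_nonneg (softmax_pos y i).le
      (InformationTheory.klFun_nonneg (div_nonneg (hp.1 i) (softmax_pos y i).le))
  have hz := (Finset.sum_eq_zero_iff_of_nonneg hn).1
    (le_antisymm (by linarith) (Finset.sum_nonneg hn))
  funext i
  have hs := softmax_pos y i
  have := (mul_eq_zero.1 (hz i (Finset.mem_univ i))).resolve_left hs.ne'
  rw [InformationTheory.klFun_eq_zero_iff (div_nonneg (hp.1 i) hs.le)] at this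
  rwa [div_eq_one_iff_eq hs.ne'] at this

/-- The bound `log (1 + u) ≥ 2u / (u + 2)` at `u = (p - q) / q`. Summed over a distribution, it
bounds the symmetrized KL divergence below with the constant needed for the sharp Lipschitz bound on
softmax. -/
theorem two_mul_sq_sub_div_le {p q : ℝ} (hp : 0 < p) (hq : 0 < q) :
    2 * ((p - q) ^ 2 / (p + q)) ≤ (p - q) * (Real.log p - Real.log q) := by
  wlog h : q ≤ p generalizing p q
  · have := this hq hp (le_of_not_ge h)
    rw [add_comm q p] at this
    calc _ = 2 * ((q - p) ^ 2 / (p + q)) := by ring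
      _ ≤ _ := this
      _ = _ := by ring
  have h1 := Real.le_log_one_add_of_nonneg (x := (p - q) / q) (div_nonneg (by linarith) hq.le)
  have e : 1 + (p - q) / q = p / q := by field_simp; ring
  have e2 : 2 * ((p - q) / q) / ((p - q) / q + 2) = 2 * ((p - q) / (p + q)) := by
    have : (p - q) / q + 2 = (p + q) / q := by field_simp; ring
    rw [this]; field_simp
  rw [e, e2, Real.log_div hp.ne' hq.ne'] at h1
  calc _ = (p - q) * (2 * ((p - q) / (p + q))) := by ring
    _ ≤ _ := mul_le_mul_of_nonneg_left h1 (by linarith)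

/-- Softmax is 1-Lipschitz from `ℓ^∞` to `ℓ^1`. -/
theorem sum_abs_softmax_sub_le {x y : ι → ℝ} {c : ℝ} (h : ∀ i, |x i - y i| ≤ c) :
    ∑ i, |softmax x i - softmax y i| ≤ c := by
  set p := softmax x with hpd
  set q := softmax y with hqd
  have hp := softmax_pos x
  have hq := softmax_pos y
  have hc : 0 ≤ c := (abs_nonneg _).trans (h (Classical.arbitrary ι))
  set D := ∑ i, |p i - q i| with hD
  have hD0 : 0 ≤ D := Finset.sum_nonneg fun i _ => abs_nonneg _
  -- Cauchy–Schwarz in Engel form; the denominators have total mass 2, which cancels the 2 of the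
  -- pointwise logarithm bound and leaves `D² ≤ D c`.
  have h1 : D ^ 2 / ∑ i, (p i + q i) ≤ ∑ i, |p i - q i| ^ 2 / (p i + q i) :=
    Finset.sq_sum_div_le_sum_sq_div _ _ fun i _ => add_pos (hp i) (hq i)
  have h2 : ∑ i, (p i + q i) = 2 := by
    rw [Finset.sum_add_distrib, hpd, hqd, sum_softmax, sum_softmax]; norm_num
  have h3 : 2 * ∑ i, |p i - q i| ^ 2 / (p i + q i) ≤
      ∑ i, (p i - q i) * (Real.log (p i) - Real.log (q i)) := by
    rw [Finset.mul_sum]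
    refine Finset.sum_le_sum fun i _ => ?_
    rw [sq_abs]
    exact two_mul_sq_sub_div_le (hp i) (hq i)
  have h4 : ∑ i, (p i - q i) * (Real.log (p i) - Real.log (q i)) =
      ∑ i, (p i - q i) * (x i - y i) := by
    -- The two normalizers enter as a constant, which `p - q` annihilates.
    have e : ∀ i, (p i - q i) * (Real.log (p i) - Real.log (q i)) =
        (p i - q i) * (x i - y i) - (p i - q i) * (logSumExp x - logSumExp y) := by
      intro i
      rw [hpd, hqd, log_softmax, log_softmax]; ring
    simp_rw [e]
    rw [Finset.sum_sub_distrib, ← Finset.sum_mul, Finset.sum_sub_distrib (f := p), hpd, hqd,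
      sum_softmax, sum_softmax]
    simp
  have h5 : ∑ i, (p i - q i) * (x i - y i) ≤ D * c := by
    rw [hD, Finset.sum_mul]
    refine Finset.sum_le_sum fun i _ => (le_abs_self _).trans ?_
    rw [abs_mul]
    exact mul_le_mul_of_nonneg_left (h i) (abs_nonneg _)
  rw [h2] at h1
  rcases hD0.eq_or_lt with h0 | h0
  · rw [← h0]; exact hc
  · have : D * D ≤ D * c := by nlinarith
    exact le_of_mul_le_mul_left this h0

end Softmax

theorem softmax_log {ι : Type*} [Fintype ι] {p : ι → ℝ} (hp : ∀ i, 0 < p i) (h1 : ∑ i, p i = 1) :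
    softmax (fun i => Real.log (p i)) = p := by
  funext i
  simp only [softmax]
  rw [Finset.sum_congr rfl fun j _ => Real.exp_log (hp j), h1, Real.exp_log (hp i), div_one]

theorem abs_sum_mul_le {ι : Type*} [Fintype ι] (u v : ι → ℝ) {b : ℝ} (h : ∀ i, |v i| ≤ b) :
    |∑ i, u i * v i| ≤ (∑ i, |u i|) * b := by
  rw [Finset.sum_mul]
  refine (Finset.abs_sum_le_sum_abs _ _).trans (Finset.sum_le_sum fun i _ => ?_)
  rw [abs_mul]
  exact mul_le_mul_of_nonneg_left (h i) (abs_nonneg _)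

theorem sum_mul_le_of_mem_stdSimplex {ι : Type*} [Fintype ι] {p : ι → ℝ}
    (hp : p ∈ stdSimplex ℝ ι) {v : ι → ℝ} {b : ℝ} (h : ∀ i, v i ≤ b) : ∑ i, p i * v i ≤ b := by
  calc _ ≤ ∑ i, p i * b := Finset.sum_le_sum fun i _ => mul_le_mul_of_nonneg_left (h i) (hp.1 i)
    _ = b := by rw [← Finset.sum_mul, hp.2, one_mul]

theorem abs_sum_mul_le_of_mem_stdSimplex {ι : Type*} [Fintype ι] {p : ι → ℝ}
    (hp : p ∈ stdSimplex ℝ ι) {v : ι → ℝ} {b : ℝ} (h : ∀ i, |v i| ≤ b) :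
    |∑ i, p i * v i| ≤ b := by
  have := abs_sum_mul_le p v h
  rwa [Finset.sum_congr rfl fun i _ => abs_of_nonneg (hp.1 i), hp.2, one_mul] at this

section SoftmaxPolicy

variable {S A : Type*} [Fintype A] [Nonempty A]

theorem softmaxPolicy_mem (θ : S × A → ℝ) (s : S) : softmaxPolicy θ s ∈ stdSimplex ℝ A :=
  softmax_mem _

theorem softmaxPolicy_pos (θ : S × A → ℝ) (s : S) (a : A) : 0 < softmaxPolicy θ s a :=
  softmax_pos _ _

theorem continuous_softmaxPolicy (s : S) (a : A) :
    Continuous fun θ : S × A → ℝ => softmaxPolicy θ s a := by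
  simp only [softmaxPolicy, softmax]
  exact Continuous.div (by fun_prop) (by fun_prop) fun θ => (sum_exp_pos _).ne'

end SoftmaxPolicy

/-! ### Discounted occupancy measures -/

namespace MOMDP

theorem one_sub_γ_pos {S A : Type*} [Fintype S] {K : ℕ} (M : MOMDP S A K) : 0 < 1 - M.γ :=
  sub_pos.2 M.γ_lt_one

variable {S A : Type*} [Fintype S] [Fintype A] {K : ℕ} (M : MOMDP S A K)

/-- The unnormalized discounted occupancy measure `∑_t γ^t Pr_{ν,π}(s_t = s)`. -/
noncomputable def occ (π : S → A → ℝ) (ν : S → ℝ) (s : S) : ℝ :=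
  ∑' t : ℕ, M.γ ^ t * M.stateDist π ν t s

theorem stateDist_mem {π : S → A → ℝ} (hπ : ∀ s, π s ∈ stdSimplex ℝ A) {ν : S → ℝ}
    (hν : ν ∈ stdSimplex ℝ S) (t : ℕ) :
    M.stateDist π ν t ∈ stdSimplex ℝ S := by
  induction t with
  | zero => exact hν
  | succ t ih =>
    refine ⟨fun s' => Finset.sum_nonneg fun s _ => Finset.sum_nonneg fun a _ =>
      mul_nonneg (mul_nonneg (ih.1 s) ((hπ s).1 a)) ((M.P_mem s a).1 s'), ?_⟩
    simp only [stateDist]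
    rw [Finset.sum_comm]
    calc _ = ∑ s, M.stateDist π ν t s := Finset.sum_congr rfl fun s _ => by
          rw [Finset.sum_comm]
          simp_rw [← Finset.mul_sum, (M.P_mem s _).2, mul_one, ← Finset.mul_sum, (hπ s).2, mul_one]
      _ = 1 := ih.2

theorem summable_occ {π : S → A → ℝ} (hπ : ∀ s, π s ∈ stdSimplex ℝ A) {ν : S → ℝ}
    (hν : ν ∈ stdSimplex ℝ S) (s : S) :
    Summable fun t : ℕ => M.γ ^ t * M.stateDist π ν t s := by
  refine Summable.of_nonneg_of_le
    (fun t => mul_nonneg (pow_nonneg M.γ_pos.le t) ((M.stateDist_mem hπ hν t).1 s)) (fun t => ?_)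
    (summable_geometric_of_lt_one M.γ_pos.le M.γ_lt_one)
  have h : M.stateDist π ν t s ≤ 1 := by
    rw [← (M.stateDist_mem hπ hν t).2]
    exact Finset.single_le_sum (fun i _ => (M.stateDist_mem hπ hν t).1 i) (Finset.mem_univ s)
  exact mul_le_of_le_one_right (pow_nonneg M.γ_pos.le t) h

theorem occ_nonneg {π : S → A → ℝ} (hπ : ∀ s, π s ∈ stdSimplex ℝ A) {ν : S → ℝ}
    (hν : ν ∈ stdSimplex ℝ S) (s : S) : 0 ≤ M.occ π ν s :=
  tsum_nonneg fun t => mul_nonneg (pow_nonneg M.γ_pos.le t) ((M.stateDist_mem hπ hν t).1 s)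

theorem occ_pos_of_stateDist_pos {π : S → A → ℝ} (hπ : ∀ s, π s ∈ stdSimplex ℝ A) {ν : S → ℝ}
    (hν : ν ∈ stdSimplex ℝ S) {s : S} {t : ℕ}
    (h : 0 < M.stateDist π ν t s) : 0 < M.occ π ν s :=
  (M.summable_occ hπ hν s).tsum_pos
    (fun t => mul_nonneg (pow_nonneg M.γ_pos.le t) ((M.stateDist_mem hπ hν t).1 s)) t
    (mul_pos (pow_pos M.γ_pos t) h)

theorem sum_occ {π : S → A → ℝ} (hπ : ∀ s, π s ∈ stdSimplex ℝ A) {ν : S → ℝ}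
    (hν : ν ∈ stdSimplex ℝ S) :
    ∑ s, M.occ π ν s = (1 - M.γ)⁻¹ := by
  simp only [occ]
  rw [← Summable.tsum_finsetSum fun s _ => M.summable_occ hπ hν s]
  simp_rw [← Finset.mul_sum, (M.stateDist_mem hπ hν _).2, mul_one]
  exact tsum_geometric_of_lt_one M.γ_pos.le M.γ_lt_one

theorem discounted_eq_sum_occ {π : S → A → ℝ} (hπ : ∀ s, π s ∈ stdSimplex ℝ A) {ν : S → ℝ}
    (hν : ν ∈ stdSimplex ℝ S) (f : S → A → ℝ) :
    M.discounted π ν f = ∑ s, M.occ π ν s * ∑ a, π s a * f s a := by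
  simp only [discounted, occ, ← tsum_mul_right]
  rw [← Summable.tsum_finsetSum fun s _ => (M.summable_occ hπ hν s).mul_right _]
  refine tsum_congr fun t => ?_
  simp_rw [Finset.mul_sum, mul_assoc]

/-- The Bellman flow equation. -/
theorem occ_eq {π : S → A → ℝ} (hπ : ∀ s, π s ∈ stdSimplex ℝ A) {ν : S → ℝ}
    (hν : ν ∈ stdSimplex ℝ S) (s' : S) :
    M.occ π ν s' = ν s' + M.γ * ∑ s, M.occ π ν s * ∑ a, π s a * M.P s a s' := by
  rw [← M.discounted_eq_sum_occ hπ hν fun s a => M.P s a s', occ,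
    (M.summable_occ hπ hν s').tsum_eq_zero_add, discounted, ← tsum_mul_left]
  simp only [pow_zero, one_mul, stateDist, pow_succ]
  congr 1
  exact tsum_congr fun t => by ring

/-- Performance difference: the discounted return of `f` compared with a potential `U`. -/
theorem discounted_sub_eq {π : S → A → ℝ} (hπ : ∀ s, π s ∈ stdSimplex ℝ A) {ν : S → ℝ}
    (hν : ν ∈ stdSimplex ℝ S) (f : S → A → ℝ) (U : S → ℝ) :
    M.discounted π ν f - ∑ s, ν s * U s =
      ∑ s, M.occ π ν s * (∑ a, π s a * (f s a + M.γ * ∑ s', M.P s a s' * U s') - U s) := by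
  have h : ∑ s', M.occ π ν s' * U s' = ∑ s', ν s' * U s' +
      ∑ s, M.occ π ν s * ∑ a, π s a * (M.γ * ∑ s', M.P s a s' * U s') := by
    conv_lhs => enter [2, s']; rw [M.occ_eq hπ hν s', add_mul]
    rw [Finset.sum_add_distrib]
    congr 1
    simp_rw [Finset.mul_sum, Finset.sum_mul]
    rw [Finset.sum_comm]
    refine Finset.sum_congr rfl fun s _ => ?_
    rw [Finset.sum_comm]
    exact Finset.sum_congr rfl fun a _ => Finset.sum_congr rfl fun s' _ => by ring
  rw [M.discounted_eq_sum_occ hπ hν]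
  simp_rw [mul_add, Finset.sum_add_distrib, mul_sub, mul_add]
  rw [Finset.sum_sub_distrib, Finset.sum_add_distrib, h]
  ring

/-- A one-sided Bellman residual is averaged against the occupancy measure, whose total mass is `1 /
(1 - γ)`. -/
theorem discounted_sub_le {π : S → A → ℝ} (hπ : ∀ s, π s ∈ stdSimplex ℝ A) {ν : S → ℝ}
    (hν : ν ∈ stdSimplex ℝ S) {f : S → A → ℝ} {U : S → ℝ}
    {b : ℝ} (h : ∀ s, ∑ a, π s a * (f s a + M.γ * ∑ s', M.P s a s' * U s') - U s ≤ b) :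
    M.discounted π ν f - ∑ s, ν s * U s ≤ b / (1 - M.γ) := by
  rw [M.discounted_sub_eq hπ hν, div_eq_mul_inv, ← M.sum_occ hπ hν, mul_comm, Finset.sum_mul]
  exact Finset.sum_le_sum fun s _ => mul_le_mul_of_nonneg_left (h s) (M.occ_nonneg hπ hν s)

theorem le_discounted_sub {π : S → A → ℝ} (hπ : ∀ s, π s ∈ stdSimplex ℝ A) {ν : S → ℝ}
    (hν : ν ∈ stdSimplex ℝ S) {f : S → A → ℝ} {U : S → ℝ}
    {b : ℝ} (h : ∀ s, b ≤ ∑ a, π s a * (f s a + M.γ * ∑ s', M.P s a s' * U s') - U s) :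
    b / (1 - M.γ) ≤ M.discounted π ν f - ∑ s, ν s * U s := by
  rw [M.discounted_sub_eq hπ hν, div_eq_mul_inv, ← M.sum_occ hπ hν, mul_comm, Finset.sum_mul]
  exact Finset.sum_le_sum fun s _ => mul_le_mul_of_nonneg_left (h s) (M.occ_nonneg hπ hν s)

/-- A solution of the Bellman equation is the value function. -/
theorem discounted_eq_of_bellman {π : S → A → ℝ} (hπ : ∀ s, π s ∈ stdSimplex ℝ A) {ν : S → ℝ}
    (hν : ν ∈ stdSimplex ℝ S) {f : S → A → ℝ} {U : S → ℝ}
    (h : ∀ s, U s = ∑ a, π s a * (f s a + M.γ * ∑ s', M.P s a s' * U s')) :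
    M.discounted π ν f = ∑ s, ν s * U s := by
  rw [← sub_eq_zero, M.discounted_sub_eq hπ hν]
  exact Finset.sum_eq_zero fun s _ => by rw [← h s, sub_self, mul_zero]

theorem abs_discounted_le {π : S → A → ℝ} (hπ : ∀ s, π s ∈ stdSimplex ℝ A) {ν : S → ℝ}
    (hν : ν ∈ stdSimplex ℝ S) {f : S → A → ℝ} {b : ℝ}
    (h : ∀ s a, |f s a| ≤ b) : |M.discounted π ν f| ≤ b / (1 - M.γ) := by
  have h1 : ∀ s, |∑ a, π s a * f s a| ≤ b := fun s =>
    abs_sum_mul_le_of_mem_stdSimplex (hπ s) (h s)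
  have hu := M.discounted_sub_le hπ hν (f := f) (U := 0) (b := b) fun s => by
    simpa using (abs_le.1 (h1 s)).2
  have hl := M.le_discounted_sub hπ hν (f := f) (U := 0) (b := -b) fun s => by
    simpa using (abs_le.1 (h1 s)).1
  simp only [Pi.zero_apply, mul_zero, Finset.sum_const_zero, sub_zero, neg_div] at hu hl
  exact abs_le.2 ⟨hl, hu⟩

section StateValue

variable [DecidableEq S]

/-- The value function solves the Bellman equation. -/
theorem discounted_single_bellman {π : S → A → ℝ} (hπ : ∀ s, π s ∈ stdSimplex ℝ A) (f : S → A → ℝ)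
    (s : S) :
    M.discounted π (Pi.single s 1) f = ∑ a, π s a * (f s a +
      M.γ * ∑ s', M.P s a s' * M.discounted π (Pi.single s' 1) f) := by
  -- the backup operator is a contraction, so the equation has a solution
  set Φ : (S → ℝ) → S → ℝ := fun U s =>
    ∑ a, π s a * (f s a + M.γ * ∑ s', M.P s a s' * U s') with hΦ
  have hc : ContractingWith ⟨M.γ, M.γ_pos.le⟩ Φ := by
    refine ⟨by exact_mod_cast M.γ_lt_one, LipschitzWith.of_dist_le_mul fun U W => ?_⟩
    refine (dist_pi_le_iff (mul_nonneg M.γ_pos.le dist_nonneg)).2 fun s => ?_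
    rw [Real.dist_eq]
    have e : Φ U s - Φ W s = ∑ a, π s a * (M.γ * ∑ s', M.P s a s' * (U s' - W s')) := by
      simp only [hΦ, ← Finset.sum_sub_distrib, mul_sub]
      exact Finset.sum_congr rfl fun a _ => by rw [Finset.sum_sub_distrib]; ring
    rw [e]
    refine abs_sum_mul_le_of_mem_stdSimplex (hπ s) fun a => ?_
    rw [abs_mul, abs_of_pos M.γ_pos]
    refine mul_le_mul_of_nonneg_left ?_ M.γ_pos.le
    refine abs_sum_mul_le_of_mem_stdSimplex (M.P_mem s a) fun s' => ?_
    rw [← Real.dist_eq]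
    exact dist_le_pi_dist U W s'
  set U := ContractingWith.fixedPoint Φ hc
  have hU : ∀ s, U s = ∑ a, π s a * (f s a + M.γ * ∑ s', M.P s a s' * U s') := fun s =>
    (congrFun hc.fixedPoint_isFixedPt s).symm
  -- The performance difference identity identifies any solution of the equation with the return.
  have hV : ∀ s, M.discounted π (Pi.single s 1) f = U s := fun s => by
    rw [M.discounted_eq_of_bellman hπ (single_mem_stdSimplex ℝ s) hU]
    simp [Pi.single_apply]
  simp_rw [hV]
  exact hU s

theorem discounted_eq_sum_single {π : S → A → ℝ} (hπ : ∀ s, π s ∈ stdSimplex ℝ A) {ν : S → ℝ}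
    (hν : ν ∈ stdSimplex ℝ S) (f : S → A → ℝ) :
    M.discounted π ν f = ∑ s, ν s * M.discounted π (Pi.single s 1) f :=
  M.discounted_eq_of_bellman hπ hν (M.discounted_single_bellman hπ f)

end StateValue

/-- A policy of full support follows every path of positive probability, so positivity spreads along
reachability. This is what determines the kernel of the Fisher matrix exactly. -/
theorem occ_pos {π : S → A → ℝ} (hπ : ∀ s, π s ∈ stdSimplex ℝ A) (hpos : ∀ s a, 0 < π s a)
    {s : S} (h : M.Reachable s) : 0 < M.occ π M.μ s := by
  suffices ∃ t, 0 < M.stateDist π M.μ t s from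
    this.elim fun t ht => M.occ_pos_of_stateDist_pos hπ M.μ_mem ht
  induction h with
  | init s h => exact ⟨0, h⟩
  | step s a s' _ h ih =>
    obtain ⟨t, ht⟩ := ih
    refine ⟨t + 1, ?_⟩
    have hn : ∀ s a, 0 ≤ M.stateDist π M.μ t s * π s a * M.P s a s' := fun s a =>
      mul_nonneg (mul_nonneg ((M.stateDist_mem hπ M.μ_mem t).1 s) (hpos s a).le)
        ((M.P_mem s a).1 s')
    exact Finset.sum_pos' (fun s _ => Finset.sum_nonneg fun a _ => hn s a)
      ⟨s, Finset.mem_univ s, Finset.sum_pos' (fun a _ => hn s a)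
        ⟨a, Finset.mem_univ a, mul_pos (mul_pos ht (hpos s a)) h⟩⟩

variable [Nonempty A]

/-- Weierstrass M-test with the geometric series. Continuity suffices: in the policy gradient the
occupancy multiplies a factor that vanishes at the base point. -/
theorem continuous_occ (s : S) :
    Continuous fun θ : S × A → ℝ => M.occ (softmaxPolicy θ) M.μ s := by
  have hd : ∀ t s, Continuous fun θ : S × A → ℝ => M.stateDist (softmaxPolicy θ) M.μ t s := by
    intro t
    induction t with
    | zero => exact fun s => continuous_const
    | succ t ih =>
      intro s'
      simp only [stateDist]
      exact continuous_finsetSum _ fun s _ => continuous_finsetSum _ fun a _ =>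
        ((ih s).mul (continuous_softmaxPolicy s a)).mul continuous_const
  refine continuous_tsum (fun t => continuous_const.mul (hd t s))
    (summable_geometric_of_lt_one M.γ_pos.le M.γ_lt_one) fun t θ => ?_
  have hm := M.stateDist_mem (softmaxPolicy_mem θ) M.μ_mem t
  have h : M.stateDist (softmaxPolicy θ) M.μ t s ≤ 1 := by
    rw [← hm.2]
    exact Finset.single_le_sum (fun i _ => hm.1 i) (Finset.mem_univ s)
  rw [Real.norm_of_nonneg (mul_nonneg (pow_nonneg M.γ_pos.le t) (hm.1 s))]
  exact mul_le_of_le_one_right (pow_nonneg M.γ_pos.le t) h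

end MOMDP

/-! ### Policy gradient and natural policy gradient -/

/-- A product whose second factor vanishes at `x` is differentiable at `x` as soon as the first
factor is continuous there. -/
theorem HasFDerivAt.continuousAt_mul_of_eq_zero {E : Type*} [NormedAddCommGroup E]
    [NormedSpace ℝ E] {f g : E → ℝ} {g' : E →L[ℝ] ℝ} {x : E} (hg : HasFDerivAt g g' x)
    (hf : ContinuousAt f x) (h0 : g x = 0) :
    HasFDerivAt (fun y => f y * g y) (f x • g') x := by
  rw [hasFDerivAt_iff_isLittleO] at hg ⊢
  have h1 : (fun y => f y * (g y - g x - g' (y - x))) =o[nhds x] fun y => y - x := by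
    have := (hf.isBigO_one ℝ).mul_isLittleO (hg.norm_right)
    simpa using this
  have h2 : (fun y => (f y - f x) * g' (y - x)) =o[nhds x] fun y => y - x := by
    have hf' : (fun y => f y - f x) =o[nhds x] fun _ => (1 : ℝ) := by
      rw [Asymptotics.isLittleO_one_iff]
      exact (tendsto_sub_nhds_zero_iff).2 hf
    have hg' : (fun y => g' (y - x)) =O[nhds x] fun y => ‖y - x‖ :=
      (g'.isBigO_sub _ _).norm_right
    have := hf'.mul_isBigO hg'
    simpa using this
  refine (h1.add h2).congr_left fun y => ?_
  simp only [h0, smul_apply, smul_eq_mul]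
  ring

section SoftmaxDeriv

variable {S A : Type*} [Fintype S] [Fintype A]

/-- This is the numerator of the regularized objective before normalization; `c = 1`, `τ = 0` gives
the partition function. -/
theorem hasFDerivAt_sum_exp_mul (θ : S × A → ℝ) (s : S) (c : A → ℝ) (τ : ℝ) :
    HasFDerivAt (fun θ' : S × A → ℝ => ∑ b, Real.exp (θ' (s, b)) * (c b - τ * θ' (s, b)))
      (∑ b, (Real.exp (θ (s, b)) * (c b - τ * θ (s, b) - τ)) •
        ContinuousLinearMap.proj (R := ℝ) (φ := fun _ : S × A => ℝ) (s, b)) θ := by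
  refine HasFDerivAt.fun_sum fun b _ => ?_
  have hp : HasFDerivAt (fun θ' : S × A → ℝ => θ' (s, b))
      (ContinuousLinearMap.proj (R := ℝ) (φ := fun _ : S × A => ℝ) (s, b)) θ :=
    hasFDerivAt_apply (s, b) θ
  refine (hp.exp.mul ((hp.const_mul τ).const_sub (c b))).congr_fderiv ?_
  ext v
  simp
  ring

theorem hasFDerivAt_sum_exp (θ : S × A → ℝ) (s : S) :
    HasFDerivAt (fun θ' : S × A → ℝ => ∑ b, Real.exp (θ' (s, b)))
      (∑ b, Real.exp (θ (s, b)) •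
        ContinuousLinearMap.proj (R := ℝ) (φ := fun _ : S × A => ℝ) (s, b)) θ := by
  simpa using hasFDerivAt_sum_exp_mul θ s (fun _ => 1) 0

theorem sum_smul_proj_single {S A : Type*} [DecidableEq S] [Fintype A] [DecidableEq A]
    (s s₀ : S) (a₀ : A) (c : A → ℝ) :
    (∑ b, c b • ContinuousLinearMap.proj (R := ℝ) (φ := fun _ : S × A => ℝ) (s, b))
      (Pi.single (s₀, a₀) 1) = if s = s₀ then c a₀ else 0 := by
  simp only [sum_apply, smul_apply,
    ContinuousLinearMap.proj_apply, Pi.single_apply, Prod.mk.injEq, smul_eq_mul, mul_ite, mul_one,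
    mul_zero]
  by_cases h : s = s₀ <;> simp [h]

variable [DecidableEq S] [DecidableEq A] [Nonempty A]

theorem gradVec_log_softmaxPolicy (θ : S × A → ℝ) (s : S) (a : A) (i : S × A) :
    gradVec (fun θ' => Real.log (softmaxPolicy θ' s a)) θ i =
      if s = i.1 then (if a = i.2 then 1 else 0) - softmaxPolicy θ s i.2 else 0 := by
  obtain ⟨s₀, a₀⟩ := i
  have hp : HasFDerivAt (fun θ' : S × A → ℝ => θ' (s, a))
      (ContinuousLinearMap.proj (R := ℝ) (φ := fun _ : S × A => ℝ) (s, a)) θ :=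
    hasFDerivAt_apply (s, a) θ
  have h := hp.fun_sub ((hasFDerivAt_sum_exp θ s).log (sum_exp_pos fun b => θ (s, b)).ne')
  have e : (fun θ' : S × A → ℝ => Real.log (softmaxPolicy θ' s a)) =
      fun θ' => θ' (s, a) - Real.log (∑ b, Real.exp (θ' (s, b))) := by
    funext θ'
    rw [softmaxPolicy, log_softmax, logSumExp]
  rw [gradVec, e, HasFDerivAt.fderiv h, sub_apply, smul_apply,
    sum_smul_proj_single]
  by_cases h : s = s₀
  · subst h
    simp [Pi.single_apply, softmaxPolicy, softmax, div_eq_inv_mul]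
  · simp [h]

/-- Derivative of the entropy-regularized one-step objective
`θ' ↦ ∑_b π_{θ'}(b|s) (c_b - τ log π_{θ'}(b|s))`. -/
theorem exists_hasFDerivAt_softmaxPolicy_objective (θ : S × A → ℝ) (s : S) (c : A → ℝ) (τ : ℝ) :
    ∃ h' : (S × A → ℝ) →L[ℝ] ℝ,
      HasFDerivAt (fun θ' => ∑ b, softmaxPolicy θ' s b *
        (c b - τ * Real.log (softmaxPolicy θ' s b))) h' θ ∧
      ∀ s₀ a₀, h' (Pi.single (s₀, a₀) 1) = if s = s₀ then softmaxPolicy θ s a₀ *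
        (c a₀ - τ * Real.log (softmaxPolicy θ s a₀) -
          ∑ b, softmaxPolicy θ s b * (c b - τ * Real.log (softmaxPolicy θ s b))) else 0 := by
  have hrepr : ∀ θ' : S × A → ℝ, ∑ b, softmaxPolicy θ' s b *
        (c b - τ * Real.log (softmaxPolicy θ' s b)) =
      (∑ b, Real.exp (θ' (s, b)) * (c b - τ * θ' (s, b))) * (∑ b, Real.exp (θ' (s, b)))⁻¹ +
        τ * Real.log (∑ b, Real.exp (θ' (s, b))) := by
    intro θ'
    simp only [softmaxPolicy, log_softmax]
    have : ∀ b, softmax (fun a => θ' (s, a)) b *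
          (c b - τ * (θ' (s, b) - logSumExp fun a => θ' (s, a))) =
        Real.exp (θ' (s, b)) * (c b - τ * θ' (s, b)) * (∑ b, Real.exp (θ' (s, b)))⁻¹ +
          softmax (fun a => θ' (s, a)) b * (τ * logSumExp fun a => θ' (s, a)) := by
      intro b; rw [softmax]; ring
    simp_rw [this]
    rw [Finset.sum_add_distrib, ← Finset.sum_mul, ← Finset.sum_mul, sum_softmax, one_mul,
      logSumExp]
  have hN0 := sum_exp_pos fun b => θ (s, b)
  have hN := hasFDerivAt_sum_exp θ s
  have hM := hasFDerivAt_sum_exp_mul θ s c τ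
  have hI := (hasDerivAt_inv hN0.ne').comp_hasFDerivAt θ hN
  have h := (hM.fun_mul hI).fun_add ((hN.log hN0.ne').const_mul τ)
  refine ⟨_, h.congr_of_eventuallyEq (Filter.Eventually.of_forall hrepr), fun s₀ a₀ => ?_⟩
  rw [hrepr]
  simp only [add_apply, smul_apply, sum_smul_proj_single, smul_eq_mul, Function.comp_apply]
  by_cases hs : s = s₀
  · subst hs
    simp only [if_true, softmaxPolicy, log_softmax, logSumExp]
    rw [softmax]
    generalize ∑ b, Real.exp (θ (s, b)) * (c b - τ * θ (s, b)) = m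
    field_simp
    ring
  · simp [hs]

end SoftmaxDeriv

namespace MOMDP

variable {S A : Type*} [Fintype S] [Fintype A] {K : ℕ} (M : MOMDP S A K)

/-- The scalarized reward `⟨w, r⟩`. -/
def scalarReward (w : Fin K → ℝ) (s : S) (a : A) : ℝ := ∑ k, w k * M.r s a k

theorem sum_mul_softValue {π : S → A → ℝ} (hπ : ∀ s, π s ∈ stdSimplex ℝ A) {w : Fin K → ℝ}
    (hw : ∑ k, w k = 1) {ν : S → ℝ}
    (hν : ν ∈ stdSimplex ℝ S) (τ : ℝ) :
    ∑ k, w k * M.softValue τ π ν k =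
      M.discounted π ν fun s a => M.scalarReward w s a - τ * Real.log (π s a) := by
  simp only [softValue, M.discounted_eq_sum_occ hπ hν]
  simp_rw [Finset.mul_sum]
  rw [Finset.sum_comm]
  refine Finset.sum_congr rfl fun s _ => ?_
  rw [Finset.sum_comm]
  refine Finset.sum_congr rfl fun a _ => ?_
  have : M.scalarReward w s a - τ * Real.log (π s a) =
      ∑ k, w k * (M.r s a k - τ * Real.log (π s a)) := by
    simp_rw [mul_sub]
    rw [Finset.sum_sub_distrib, ← Finset.sum_mul, hw, one_mul, scalarReward]
  rw [this]
  simp_rw [Finset.mul_sum]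
  exact Finset.sum_congr rfl fun k _ => by ring

variable [DecidableEq S]

/-- The soft value function of `π` for the scalar reward `g`. -/
noncomputable def softV (τ : ℝ) (g : S → A → ℝ) (π : S → A → ℝ) (s : S) : ℝ :=
  M.discounted π (Pi.single s 1) fun s a => g s a - τ * Real.log (π s a)

/-- The soft action-value function of `π` for the scalar reward `g`. -/
noncomputable def softQScalar (τ : ℝ) (g : S → A → ℝ) (π : S → A → ℝ) (s : S) (a : A) : ℝ :=
  g s a + M.γ * ∑ s', M.P s a s' * M.softV τ g π s'

theorem softV_eq {π : S → A → ℝ} (hπ : ∀ s, π s ∈ stdSimplex ℝ A) (τ : ℝ) (g : S → A → ℝ) (s : S) :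
    M.softV τ g π s = ∑ a, π s a * (M.softQScalar τ g π s a - τ * Real.log (π s a)) := by
  rw [softV, M.discounted_single_bellman hπ]
  exact Finset.sum_congr rfl fun a _ => by rw [softQScalar]; simp only [softV]; ring

theorem softQ_eq {π : S → A → ℝ} (hπ : ∀ s, π s ∈ stdSimplex ℝ A) {w : Fin K → ℝ}
    (hw : ∑ k, w k = 1) (τ : ℝ) :
    M.softQ τ π w = M.softQScalar τ (M.scalarReward w) π := by
  funext s a
  simp only [softQ, softQScalar, softV]
  simp_rw [M.sum_mul_softValue hπ hw (single_mem_stdSimplex ℝ _) τ]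
  rfl

variable [DecidableEq A] [Nonempty A]

/-- The policy gradient theorem for the entropy-regularized return. -/
theorem gradVec_discounted (τ : ℝ) (g : S → A → ℝ) (θ : S × A → ℝ) (i : S × A) :
    gradVec (fun θ' => M.discounted (softmaxPolicy θ') M.μ
        fun s a => g s a - τ * Real.log (softmaxPolicy θ' s a)) θ i =
      M.occ (softmaxPolicy θ) M.μ i.1 * (softmaxPolicy θ i.1 i.2 *
        (M.softQScalar τ g (softmaxPolicy θ) i.1 i.2
          - τ * Real.log (softmaxPolicy θ i.1 i.2) - M.softV τ g (softmaxPolicy θ) i.1)) := by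
  obtain ⟨s₀, a₀⟩ := i
  set Q := M.softQScalar τ g (softmaxPolicy θ)
  set V := M.softV τ g (softmaxPolicy θ)
  have hV : ∀ s, V s = ∑ b, softmaxPolicy θ s b *
      (Q s b - τ * Real.log (softmaxPolicy θ s b)) :=
    M.softV_eq (softmaxPolicy_mem θ) τ g
  choose h' hd hs using fun s => exists_hasFDerivAt_softmaxPolicy_objective θ s (Q s) τ
  -- Performance difference with the value at `θ` frozen as potential: each occupancy is multiplied
  -- by a one-step advantage that is zero at `θ' = θ`, so the occupancy is never differentiated.
  have hrepr : ∀ θ' : S × A → ℝ, M.discounted (softmaxPolicy θ') M.μ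
        (fun s a => g s a - τ * Real.log (softmaxPolicy θ' s a)) =
      ∑ s, M.occ (softmaxPolicy θ') M.μ s * (∑ b, softmaxPolicy θ' s b *
        (Q s b - τ * Real.log (softmaxPolicy θ' s b)) - V s) + ∑ s, M.μ s * V s := by
    intro θ'
    rw [← sub_eq_iff_eq_add, M.discounted_sub_eq (softmaxPolicy_mem θ') M.μ_mem]
    refine Finset.sum_congr rfl fun s _ => ?_
    congr 2
    exact Finset.sum_congr rfl fun a _ => by simp only [Q, V, softQScalar]; ring
  have hD : HasFDerivAt (fun θ' => M.discounted (softmaxPolicy θ') M.μ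
        fun s a => g s a - τ * Real.log (softmaxPolicy θ' s a))
      (∑ s, M.occ (softmaxPolicy θ) M.μ s • h' s) θ := by
    refine HasFDerivAt.congr_of_eventuallyEq ?_ (Filter.Eventually.of_forall hrepr)
    refine HasFDerivAt.add_const _ (HasFDerivAt.fun_sum fun s _ => ?_)
    exact ((hd s).sub_const (V s)).continuousAt_mul_of_eq_zero
      (M.continuous_occ s).continuousAt (by rw [← hV s, sub_self])
  rw [gradVec, hD.fderiv]
  simp only [sum_apply, smul_apply, smul_eq_mul, hs, ← hV]
  simp

/-- The score at `(s, a)` involves only the logits at `s`, so the matrix is block diagonal with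
blocks proportional to `diag π - π πᵀ`. Where the occupancy and the policy are positive, such a
block kills only constants. -/
theorem fisher_mulVec (θ x : S × A → ℝ) (s : S) (a : A) :
    (M.fisher θ *ᵥ x) (s, a) = (1 - M.γ) * M.occ (softmaxPolicy θ) M.μ s *
      (softmaxPolicy θ s a * (x (s, a) - ∑ b, softmaxPolicy θ s b * x (s, b))) := by
  have hdot : ∀ s b, gradVec (fun θ' => Real.log (softmaxPolicy θ' s b)) θ ⬝ᵥ x =
      x (s, b) - ∑ c, softmaxPolicy θ s c * x (s, c) := by
    intro s b
    simp only [dotProduct, gradVec_log_softmaxPolicy, Fintype.sum_prod_type]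
    rw [Finset.sum_eq_single s (fun s' _ h => by simp [h.symm]) (by simp)]
    simp [sub_mul, Finset.sum_sub_distrib]
  simp only [fisher, Matrix.sum_mulVec, Matrix.smul_mulVec, Matrix.vecMulVec_mulVec,
    Finset.sum_apply, Pi.smul_apply, hdot, gradVec_log_softmaxPolicy, smul_eq_mul,
    MulOpposite.smul_eq_mul_unop, MulOpposite.unop_op]
  rw [Finset.sum_eq_single s (fun s' _ h => by simp [h]) (by simp)]
  simp only [if_true]
  set X := ∑ b, softmaxPolicy θ s b * x (s, b) with hX
  have h1 : ∑ b, softmaxPolicy θ s b = 1 := (softmaxPolicy_mem θ s).2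
  have e : ∀ b, M.visitation (softmaxPolicy θ) s * softmaxPolicy θ s b *
        (((if b = a then 1 else 0) - softmaxPolicy θ s a) * (x (s, b) - X)) =
      M.visitation (softmaxPolicy θ) s * ((if b = a then softmaxPolicy θ s b * (x (s, b) - X)
        else 0) - softmaxPolicy θ s a * (softmaxPolicy θ s b * x (s, b) -
          softmaxPolicy θ s b * X)) := by
    intro b
    split_ifs <;> ring
  simp_rw [e]
  rw [← Finset.mul_sum, Finset.sum_sub_distrib, ← Finset.mul_sum, Finset.sum_sub_distrib,
    ← Finset.sum_mul, h1, ← hX]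
  simp [visitation, occ]

/-- A natural policy gradient step, up to a constant in each state. -/
theorem exists_npgStep_eq (hM : ∀ s, M.Reachable s) (η τ : ℝ) (θ : S × A → ℝ) {w : Fin K → ℝ}
    (hw : ∑ k, w k = 1) : ∃ c : S → ℝ, ∀ s a, M.npgStep η τ θ w (s, a) =
      θ (s, a) + η / (1 - M.γ) * (M.softQ τ (softmaxPolicy θ) w s a
        - τ * Real.log (softmaxPolicy θ s a)) + c s := by
  have hπ := softmaxPolicy_mem θ
  have hγ := M.one_sub_γ_pos
  set F := M.fisher θ with hF
  set Q := M.softQScalar τ (M.scalarReward w) (softmaxPolicy θ) with hQ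
  set V := M.softV τ (M.scalarReward w) (softmaxPolicy θ) with hVd
  have hV : ∀ s, V s = ∑ b, softmaxPolicy θ s b *
      (Q s b - τ * Real.log (softmaxPolicy θ s b)) :=
    M.softV_eq hπ τ _
  set G := ∑ k, w k • gradVec (fun θ' => M.softValue τ (softmaxPolicy θ') M.μ k) θ with hG
  -- The soft advantage over `1 - γ` is an explicit preimage of the gradient under the Fisher
  -- matrix.
  set x : S × A → ℝ := fun i => (1 - M.γ)⁻¹ *
    (Q i.1 i.2 - τ * Real.log (softmaxPolicy θ i.1 i.2) - V i.1) with hx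
  have hVk : ∀ s, ∑ k, w k * M.softV τ (fun s a => M.r s a k) (softmaxPolicy θ) s = V s := fun s =>
    M.sum_mul_softValue hπ hw (single_mem_stdSimplex ℝ s) τ
  have hQk : ∀ s a, ∑ k, w k * M.softQScalar τ (fun s a => M.r s a k) (softmaxPolicy θ) s a =
      Q s a := by
    intro s a
    rw [hQ, ← M.softQ_eq hπ hw]
    simp only [softQ, softQScalar, mul_add, Finset.sum_add_distrib]
    congr 1
    simp_rw [Finset.mul_sum]
    rw [Finset.sum_comm]
    exact Finset.sum_congr rfl fun s' _ => Finset.sum_congr rfl fun k _ => by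
      rw [softV, softValue]; ring
  have hGx : G = F *ᵥ x := by
    funext ⟨s, a⟩
    have h1 : ∑ b, softmaxPolicy θ s b * x (s, b) = 0 := by
      have : ∀ b, softmaxPolicy θ s b * x (s, b) = (1 - M.γ)⁻¹ * (softmaxPolicy θ s b *
          (Q s b - τ * Real.log (softmaxPolicy θ s b)) - softmaxPolicy θ s b * V s) := by
        intro b; rw [hx]; ring
      simp_rw [this]
      rw [← Finset.mul_sum, Finset.sum_sub_distrib, ← hV, ← Finset.sum_mul, (hπ s).2]
      ring
    rw [hF, M.fisher_mulVec, h1, hG, Finset.sum_apply]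
    simp only [Pi.smul_apply, smul_eq_mul, softValue, M.gradVec_discounted]
    have : ∀ k, w k * (M.occ (softmaxPolicy θ) M.μ s * (softmaxPolicy θ s a *
        (M.softQScalar τ (fun s a => M.r s a k) (softmaxPolicy θ) s a
          - τ * Real.log (softmaxPolicy θ s a)
          - M.softV τ (fun s a => M.r s a k) (softmaxPolicy θ) s))) =
        M.occ (softmaxPolicy θ) M.μ s * softmaxPolicy θ s a *
        (w k * M.softQScalar τ (fun s a => M.r s a k) (softmaxPolicy θ) s a
          - w k * (τ * Real.log (softmaxPolicy θ s a))
          - w k * M.softV τ (fun s a => M.r s a k) (softmaxPolicy θ) s) := fun k => by ring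
    simp_rw [this]
    rw [← Finset.mul_sum, Finset.sum_sub_distrib, Finset.sum_sub_distrib, hQk, hVk,
      ← Finset.sum_mul, hw, hx]
    field_simp
    ring
  set y := moorePenrose F *ᵥ G with hy
  -- Since `G = F x`, the identity `F F† F = F` shows that `F† G` and `x` differ by a kernel
  -- element, that is, by a function of the state.
  have hker : F *ᵥ (y - x) = 0 := by
    rw [Matrix.mulVec_sub, hy, hGx, Matrix.mulVec_mulVec, Matrix.mulVec_mulVec,
      (moorePenrose_spec F).mul_mul_self, sub_self]
  refine ⟨fun s => η * ((∑ b, softmaxPolicy θ s b * (y - x) (s, b)) - (1 - M.γ)⁻¹ * V s),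
    fun s a => ?_⟩
  have h0 := congrFun hker (s, a)
  rw [hF, M.fisher_mulVec, Pi.zero_apply] at h0
  have h1 := (mul_eq_zero.1 ((mul_eq_zero.1 h0).resolve_left
    (mul_pos hγ (M.occ_pos hπ (softmaxPolicy_pos θ) (hM s))).ne')).resolve_left
    (softmaxPolicy_pos θ s a).ne'
  have h2 : y (s, a) = x (s, a) + ∑ b, softmaxPolicy θ s b * (y - x) (s, b) := by
    have : (y - x) (s, a) = y (s, a) - x (s, a) := rfl
    linarith
  rw [M.softQ_eq hπ hw, npgStep, ← hF, ← hG, ← hy, Pi.add_apply, Pi.smul_apply, smul_eq_mul, h2, hx]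
  ring

end MOMDP

/-! ### Soft maximum at temperature `τ` -/

section SoftMax

variable {ι : Type*} [Fintype ι] [Nonempty ι]

theorem sum_mul_sub_mul_log_le {τ : ℝ} (hτ : 0 < τ) (q : ι → ℝ) {p : ι → ℝ}
    (hp : p ∈ stdSimplex ℝ ι) :
    ∑ i, p i * (q i - τ * Real.log (p i)) ≤ τ * logSumExp fun i => q i / τ := by
  refine le_of_eq_of_le ?_
    (mul_le_mul_of_nonneg_left (sum_mul_sub_log_le_logSumExp (fun i => q i / τ) hp) hτ.le)
  rw [Finset.mul_sum]
  exact Finset.sum_congr rfl fun i _ => by field_simp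

theorem sum_softmax_mul_sub_mul_log {τ : ℝ} (hτ : 0 < τ) (q : ι → ℝ) :
    ∑ i, softmax (fun i => q i / τ) i * (q i - τ * Real.log (softmax (fun i => q i / τ) i)) =
      τ * logSumExp fun i => q i / τ := by
  rw [← sum_softmax_mul_sub_log, Finset.mul_sum]
  exact Finset.sum_congr rfl fun i _ => by field_simp

theorem eq_softmax_of_mul_logSumExp_le {τ : ℝ} (hτ : 0 < τ) {q p : ι → ℝ}
    (hp : p ∈ stdSimplex ℝ ι)
    (h : (τ * logSumExp fun i => q i / τ) ≤ ∑ i, p i * (q i - τ * Real.log (p i))) :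
    p = softmax fun i => q i / τ := by
  refine eq_softmax_of_logSumExp_le hp (le_of_mul_le_mul_left (h.trans_eq ?_) hτ)
  rw [Finset.mul_sum]
  exact Finset.sum_congr rfl fun i _ => by field_simp

/-- Moving the logits part of the way towards `q / τ` improves the regularized objective. -/
theorem sum_softmax_mul_sub_le_of_interpolation {τ ε : ℝ} (hτ : 0 < τ) (hε : 0 < ε) (hε1 : ε ≤ 1)
    (q x y : ι → ℝ) (hy : ∀ i, y i = (1 - ε) * x i + ε * (q i / τ)) :
    ∑ i, softmax x i * (q i - τ * Real.log (softmax x i)) ≤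
      ∑ i, softmax y i * (q i - τ * Real.log (softmax y i)) := by
  -- Gibbs is used twice: `softmax y` beats `softmax x` for the potential `y`, and loses to it for
  -- `x`. As `y` is a mixture of `x` and `q / τ`, the gain must come from the `q / τ` part.
  have hA := sum_mul_sub_log_le_logSumExp y (softmax_mem x)
  have hB := sum_mul_sub_log_le_logSumExp x (softmax_mem y)
  rw [← sum_softmax_mul_sub_log] at hA hB
  have e : ∀ p : ι → ℝ, ∑ i, p i * (y i - Real.log (p i)) =
      (1 - ε) * ∑ i, p i * (x i - Real.log (p i)) +
        ε / τ * ∑ i, p i * (q i - τ * Real.log (p i)) := by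
    intro p
    rw [Finset.mul_sum, Finset.mul_sum, ← Finset.sum_add_distrib]
    exact Finset.sum_congr rfl fun i _ => by rw [hy]; field_simp; ring
  rw [e, e] at hA
  have h1 := mul_le_mul_of_nonneg_left hB (sub_nonneg.2 hε1)
  exact le_of_mul_le_mul_left (by linarith) (div_pos hε hτ)

end SoftMax

/-! ### Soft Bellman optimality, best responses and comparison of soft action values. -/

namespace MOMDP

/-- The level `c / (1 - γ)` is the fixed point of `v ↦ c + γ v`, so a Bellman backup does not exceed
it. -/
theorem add_γ_mul_sum_P_le {S A : Type*} [Fintype S] {K : ℕ} (M : MOMDP S A K) {b c : ℝ} {U : S → ℝ}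
    (hb : b ≤ c) (h : ∀ s, U s ≤ c / (1 - M.γ)) (s : S) (a : A) :
    b + M.γ * ∑ s', M.P s a s' * U s' ≤ c / (1 - M.γ) := by
  have h1 := mul_le_mul_of_nonneg_left (sum_mul_le_of_mem_stdSimplex (M.P_mem s a) h) M.γ_pos.le
  have h2 : c / (1 - M.γ) = c + M.γ * (c / (1 - M.γ)) := by
    have := M.one_sub_γ_pos.ne'
    field_simp
    ring
  linarith

variable {S A : Type*} [Fintype S] [Fintype A] {K : ℕ} (M : MOMDP S A K)

/-- `Q` solves the soft Bellman optimality equation for the scalar reward `g`. -/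
def IsSoftOptimal (τ : ℝ) (g Q : S → A → ℝ) : Prop :=
  ∀ s a, Q s a = g s a + M.γ * ∑ s', M.P s a s' * (τ * logSumExp fun b => Q s' b / τ)

theorem abs_r_le (s : S) (a : A) (k : Fin K) : |M.r s a k| ≤ ‖M.r‖ :=
  ((norm_le_pi_norm (M.r s a) k).trans (norm_le_pi_norm (M.r s) a)).trans (norm_le_pi_norm M.r s)

theorem abs_scalarReward_sub_le (w w' : Fin K → ℝ) (s : S) (a : A) :
    |M.scalarReward w s a - M.scalarReward w' s a| ≤ ‖M.r‖ * ∑ k, |w k - w' k| := by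
  rw [scalarReward, scalarReward, ← Finset.sum_sub_distrib, mul_comm]
  simp_rw [← sub_mul]
  exact abs_sum_mul_le _ _ (M.abs_r_le s a)

theorem utility_eq [Nonempty A] (τ τw : ℝ) (θ : S × A → ℝ) (w : Fin K → ℝ) :
    M.utility τ τw θ w = M.discounted (softmaxPolicy θ) M.μ
      (fun s a => M.scalarReward w s a - τ * Real.log (softmaxPolicy θ s a))
      - τw * shannonEntropy w := by
  rw [utility]
  congr 1
  simp only [value, policyEntropy, M.discounted_eq_sum_occ (softmaxPolicy_mem θ) M.μ_mem,
    Finset.mul_sum]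
  rw [Finset.sum_comm, ← Finset.sum_add_distrib]
  refine Finset.sum_congr rfl fun s _ => ?_
  rw [Finset.sum_comm, ← Finset.sum_add_distrib]
  refine Finset.sum_congr rfl fun a _ => ?_
  rw [scalarReward, mul_sub, mul_sub, Finset.mul_sum, Finset.mul_sum, sub_eq_add_neg]
  congr 1
  · exact Finset.sum_congr rfl fun k _ => by ring
  · ring

/-- For a fixed policy the adversary faces a Gibbs problem at temperature `τ_w` with potential `-V /
τ_w`. -/
theorem neg_utility_eq (τ : ℝ) {τw : ℝ} (hτw : 0 < τw) (θ : S × A → ℝ) (w : Fin K → ℝ) :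
    -M.utility τ τw θ w = -(τ * M.policyEntropy (softmaxPolicy θ)) +
      τw * ∑ k, w k * (-M.value (softmaxPolicy θ) k / τw - Real.log (w k)) := by
  have e : τw * ∑ k, w k * (-M.value (softmaxPolicy θ) k / τw - Real.log (w k)) =
      -∑ k, w k * M.value (softmaxPolicy θ) k - τw * ∑ k, w k * Real.log (w k) := by
    rw [Finset.mul_sum, Finset.mul_sum, ← Finset.sum_neg_distrib, ← Finset.sum_sub_distrib]
    exact Finset.sum_congr rfl fun k _ => by field_simp
  rw [e, utility, shannonEntropy]
  ring

theorem IsNash.weight_eq {M : MOMDP S A K} [NeZero K] {τ τw : ℝ} (hτw : 0 < τw) {θ : S × A → ℝ}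
    {w : Fin K → ℝ}
    (h : M.IsNash τ τw θ w) :
    w = softmax fun k => -M.value (softmaxPolicy θ) k / τw := by
  refine eq_softmax_of_logSumExp_le h.mem ?_
  have h1 := h.adversary _ (softmax_mem fun k => -M.value (softmaxPolicy θ) k / τw)
  rw [M.neg_utility_eq τ hτw, M.neg_utility_eq τ hτw, sum_softmax_mul_sub_log] at h1
  exact le_of_mul_le_mul_left (by linarith) hτw

variable [DecidableEq S]

/-- Lipschitz dependence of the return on the policy. -/
theorem abs_discounted_sub_le {π π' : S → A → ℝ} (hπ : ∀ s, π s ∈ stdSimplex ℝ A)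
    (hπ' : ∀ s, π' s ∈ stdSimplex ℝ A) {ν : S → ℝ} (hν : ν ∈ stdSimplex ℝ S) {g : S → A → ℝ}
    {R d : ℝ} (hR : 0 ≤ R) (hg : ∀ s a, |g s a| ≤ R) (hd : ∀ s, ∑ a, |π s a - π' s a| ≤ d) :
    |M.discounted π ν g - M.discounted π' ν g| ≤ d * R / (1 - M.γ) ^ 2 := by
  have hγ := M.one_sub_γ_pos
  -- With the value of `π'` as potential, the residual of `π` is at most `d` times the bound `R / (1
  -- - γ)` on action values; summing along the trajectory costs the second factor `1 / (1 - γ)`.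
  set U : S → ℝ := fun s => M.discounted π' (Pi.single s 1) g with hU
  have hUb : ∀ s, |U s| ≤ R / (1 - M.γ) := fun s =>
    M.abs_discounted_le hπ' (single_mem_stdSimplex ℝ s) hg
  have hq : ∀ s a, |g s a + M.γ * ∑ s', M.P s a s' * U s'| ≤ R / (1 - M.γ) := by
    intro s a
    rw [abs_le']
    refine ⟨M.add_γ_mul_sum_P_le (abs_le.1 (hg s a)).2 (fun s => (abs_le.1 (hUb s)).2) s a, ?_⟩
    have := M.add_γ_mul_sum_P_le (b := -g s a) (U := fun s => -U s) (c := R)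
      (neg_le.1 (abs_le.1 (hg s a)).1) (fun s => neg_le.1 (abs_le.1 (hUb s)).1) s a
    simp only [mul_neg, Finset.sum_neg_distrib] at this
    linarith
  have hone : ∀ s, |∑ a, π s a * (g s a + M.γ * ∑ s', M.P s a s' * U s') - U s| ≤
      d * (R / (1 - M.γ)) := by
    intro s
    have e : U s = ∑ a, π' s a * (g s a + M.γ * ∑ s', M.P s a s' * U s') :=
      M.discounted_single_bellman hπ' g s
    rw [e, ← Finset.sum_sub_distrib]
    simp_rw [← sub_mul]
    exact (abs_sum_mul_le _ _ (hq s)).trans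
      (mul_le_mul_of_nonneg_right (hd s) (div_nonneg hR hγ.le))
  have hu := M.discounted_sub_le hπ hν (f := g) fun s => (abs_le.1 (hone s)).2
  have hl := M.le_discounted_sub hπ hν (f := g) fun s => (abs_le.1 (hone s)).1
  have e : d * R / (1 - M.γ) ^ 2 = d * (R / (1 - M.γ)) / (1 - M.γ) := by
    field_simp
  rw [M.discounted_eq_sum_single hπ' hν g, e]
  rw [neg_div] at hl
  exact abs_le.2 ⟨hl, hu⟩

variable [Nonempty A]

section Comparison

variable {M} {τ : ℝ}

/-- By Gibbs, the residual of any policy against the optimal potential is nonpositive, apart from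
the reward discrepancy. -/
theorem IsSoftOptimal.softV_le (hτ : 0 < τ) {g g' Q : S → A → ℝ} (hQ : M.IsSoftOptimal τ g' Q)
    {π : S → A → ℝ} (hπ : ∀ s, π s ∈ stdSimplex ℝ A) {δ : ℝ} (hg : ∀ s a, g s a ≤ g' s a + δ)
    (s : S) : M.softV τ g π s - (τ * logSumExp fun b => Q s b / τ) ≤ δ / (1 - M.γ) := by
  have h := M.discounted_sub_le hπ (single_mem_stdSimplex ℝ s)
    (f := fun s a => g s a - τ * Real.log (π s a))
    (U := fun s => τ * logSumExp fun b => Q s b / τ) (b := δ) fun s => by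
      have h1 := sum_mul_sub_mul_log_le hτ (Q s) (hπ s)
      have h2 : ∑ a, π s a * (g s a - τ * Real.log (π s a) +
            M.γ * ∑ s', M.P s a s' * (τ * logSumExp fun b => Q s' b / τ)) ≤
          ∑ a, (π s a * (Q s a - τ * Real.log (π s a)) + π s a * δ) := by
        refine Finset.sum_le_sum fun a _ => ?_
        rw [← mul_add]
        refine mul_le_mul_of_nonneg_left ?_ ((hπ s).1 a)
        rw [hQ s a]
        linarith [hg s a]
      rw [Finset.sum_add_distrib, ← Finset.sum_mul, (hπ s).2, one_mul] at h2
      linarith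
  simpa [softV, Pi.single_apply] using h

theorem IsSoftOptimal.softQScalar_sub_le (hτ : 0 < τ) {g g' Q : S → A → ℝ}
    (hQ : M.IsSoftOptimal τ g' Q)
    {π : S → A → ℝ} (hπ : ∀ s, π s ∈ stdSimplex ℝ A) {δ : ℝ} (hg : ∀ s a, g s a ≤ g' s a + δ)
    (s : S) (a : A) : M.softQScalar τ g π s a - Q s a ≤ δ / (1 - M.γ) := by
  have h := M.add_γ_mul_sum_P_le (b := g s a - g' s a) (c := δ) (by linarith [hg s a])
    (hQ.softV_le hτ hπ hg) s a
  simp_rw [mul_sub, Finset.sum_sub_distrib] at h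
  rw [hQ s a, softQScalar]
  linarith

theorem IsSoftOptimal.softV_eq_of_softmax (hτ : 0 < τ) {g Q : S → A → ℝ}
    (hQ : M.IsSoftOptimal τ g Q)
    {π : S → A → ℝ} (hπ : ∀ s, π s = softmax fun a => Q s a / τ) (s : S) :
    M.softV τ g π s = τ * logSumExp fun b => Q s b / τ := by
  have hm : ∀ s, π s ∈ stdSimplex ℝ A := fun s => by rw [hπ s]; exact softmax_mem _
  rw [softV, M.discounted_eq_of_bellman hm (single_mem_stdSimplex ℝ s)
    (U := fun s => τ * logSumExp fun b => Q s b / τ)]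
  · simp [Pi.single_apply]
  · intro s
    rw [← sum_softmax_mul_sub_mul_log hτ, ← hπ s]
    refine Finset.sum_congr rfl fun a _ => ?_
    rw [hQ s a]
    ring

/-- Equality in Gibbs turns the evaluation equation of such a policy into the optimality equation.
-/
theorem isSoftOptimal_of_softmax (hτ : 0 < τ) {g : S → A → ℝ} {π : S → A → ℝ}
    (hπ : ∀ s, π s = softmax fun a => M.softQScalar τ g π s a / τ) :
    M.IsSoftOptimal τ g (M.softQScalar τ g π) := by
  have hm : ∀ s, π s ∈ stdSimplex ℝ A := fun s => by rw [hπ s]; exact softmax_mem _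
  have hV : ∀ s, M.softV τ g π s = τ * logSumExp fun b => M.softQScalar τ g π s b / τ := by
    intro s
    rw [← sum_softmax_mul_sub_mul_log hτ, ← hπ s]
    exact M.softV_eq hm τ g s
  intro s a
  simp_rw [← hV]
  rfl

/-- Insert `τ logSumExp ξ` between the two values. It is within `x` of the optimal value by
monotonicity, and exceeds the value of `softmaxPolicy ξ` by exactly the policy average of `τ ξ - Q`,
at most `m`. Hence `m` need only be one-sided, which is all that policy improvement controls. -/
theorem IsSoftOptimal.sub_softQScalar_le (hτ : 0 < τ) {g g' Q : S → A → ℝ}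
    (hQ : M.IsSoftOptimal τ g' Q)
    {ξ : S × A → ℝ} {δ x m : ℝ} (hg : ∀ s a, g' s a ≤ g s a + δ)
    (hx : ∀ s a, Q s a - τ * ξ (s, a) ≤ x)
    (hm : ∀ s a, τ * ξ (s, a) - M.softQScalar τ g (softmaxPolicy ξ) s a ≤ m) (s : S) (a : A) :
    Q s a - M.softQScalar τ g (softmaxPolicy ξ) s a ≤ δ + M.γ * (x + m) := by
  have hV : ∀ s, (τ * logSumExp fun b => Q s b / τ) - M.softV τ g (softmaxPolicy ξ) s ≤ x + m := by
    intro s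
    have hπ := softmaxPolicy_mem ξ s
    have h1 : (logSumExp fun b => Q s b / τ) ≤ (logSumExp fun b => ξ (s, b)) + x / τ := by
      refine logSumExp_le fun b => ?_
      rw [← sub_le_iff_le_add', div_sub' hτ.ne']
      exact div_le_div_of_nonneg_right (hx s b) hτ.le
    have h2 : τ * (logSumExp fun b => Q s b / τ) ≤ τ * (logSumExp fun b => ξ (s, b)) + x :=
      (mul_le_mul_of_nonneg_left h1 hτ.le).trans_eq (by field_simp)
    have h3 : τ * (logSumExp fun b => ξ (s, b)) - M.softV τ g (softmaxPolicy ξ) s =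
        ∑ b, softmaxPolicy ξ s b *
          (τ * ξ (s, b) - M.softQScalar τ g (softmaxPolicy ξ) s b) := by
      rw [M.softV_eq (softmaxPolicy_mem ξ), ← sum_softmax_mul_sub_log, Finset.mul_sum,
        ← Finset.sum_sub_distrib]
      exact Finset.sum_congr rfl fun b _ => by simp only [softmaxPolicy]; ring
    have h4 := sum_mul_le_of_mem_stdSimplex hπ (hm s)
    linarith
  have h5 := mul_le_mul_of_nonneg_left (sum_mul_le_of_mem_stdSimplex (M.P_mem s a) hV) M.γ_pos.le
  simp_rw [mul_sub, Finset.sum_sub_distrib] at h5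
  rw [hQ s a, softQScalar]
  linarith [hg s a]

/-- Policy improvement under a perturbation of the reward. -/
theorem softQScalar_sub_le_of_interpolation (hτ : 0 < τ) {ε : ℝ} (hε : 0 < ε) (hε1 : ε ≤ 1)
    {g g' : S → A → ℝ} {ξ ξ' : S × A → ℝ} {δ : ℝ} (hg : ∀ s a, g s a ≤ g' s a + δ)
    (hξ : ∀ s a, ξ' (s, a) = (1 - ε) * ξ (s, a) +
      ε * (M.softQScalar τ g (softmaxPolicy ξ) s a / τ)) (s : S) (a : A) :
    M.softQScalar τ g (softmaxPolicy ξ) s a - M.softQScalar τ g' (softmaxPolicy ξ') s a ≤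
      δ / (1 - M.γ) := by
  have hV : ∀ s, M.softV τ g (softmaxPolicy ξ) s - M.softV τ g' (softmaxPolicy ξ') s ≤
      δ / (1 - M.γ) := by
    intro s
    have h := M.le_discounted_sub (softmaxPolicy_mem ξ') (single_mem_stdSimplex ℝ s)
      (f := fun s a => g' s a - τ * Real.log (softmaxPolicy ξ' s a))
      (U := fun s => M.softV τ g (softmaxPolicy ξ) s) (b := -δ) fun s => by
        have h1 := sum_softmax_mul_sub_le_of_interpolation hτ hε hε1
          (M.softQScalar τ g (softmaxPolicy ξ) s) (fun a => ξ (s, a)) (fun a => ξ' (s, a)) (hξ s)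
        have h2 : M.softV τ g (softmaxPolicy ξ) s = _ := M.softV_eq (softmaxPolicy_mem ξ) τ g s
        have hm := softmaxPolicy_mem ξ' s
        have h3 : ∑ a, (softmaxPolicy ξ' s a * (M.softQScalar τ g (softmaxPolicy ξ) s a
              - τ * Real.log (softmaxPolicy ξ' s a)) - softmaxPolicy ξ' s a * δ) ≤
            ∑ a, softmaxPolicy ξ' s a * (g' s a - τ * Real.log (softmaxPolicy ξ' s a) +
              M.γ * ∑ s', M.P s a s' * M.softV τ g (softmaxPolicy ξ) s') := by
          refine Finset.sum_le_sum fun a _ => ?_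
          rw [← mul_sub]
          refine mul_le_mul_of_nonneg_left ?_ (hm.1 a)
          rw [softQScalar]
          linarith [hg s a]
        rw [Finset.sum_sub_distrib, ← Finset.sum_mul, hm.2, one_mul] at h3
        simp only [softmaxPolicy] at h1 h2 h3 ⊢
        linarith
    rw [neg_div] at h
    have e : ∑ s', (Pi.single s 1 : S → ℝ) s' * M.softV τ g (softmaxPolicy ξ) s' =
        M.softV τ g (softmaxPolicy ξ) s := by simp [Pi.single_apply]
    rw [e] at h
    change _ ≤ M.softV τ g' (softmaxPolicy ξ') s - _ at h
    linarith
  have h := M.add_γ_mul_sum_P_le (b := g s a - g' s a) (c := δ) (by linarith [hg s a]) hV s a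
  simp_rw [mul_sub, Finset.sum_sub_distrib] at h
  rw [softQScalar, softQScalar]
  linarith

end Comparison

/-! ### Nash equilibria of the regularized game -/

section Nash

variable {M} {τ τw : ℝ}

/-- Deviating to the softmax of `Q / τ` gains a sum of nonnegative Gibbs gaps weighted by
occupancies. At equilibrium the gain is not positive, and all states are visited, so every gap is
zero. -/
theorem IsNash.policy_eq (hM : ∀ s, M.Reachable s) (hτ : 0 < τ) {θ : S × A → ℝ} {w : Fin K → ℝ}
    (h : M.IsNash τ τw θ w) (s : S) : softmaxPolicy θ s =
      softmax fun a => M.softQScalar τ (M.scalarReward w) (softmaxPolicy θ) s a / τ := by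
  set g := M.scalarReward w with hg
  set π := softmaxPolicy θ with hπd
  set Q := M.softQScalar τ g π with hQ
  have hπ : ∀ s, π s ∈ stdSimplex ℝ A := softmaxPolicy_mem θ
  set θ' : S × A → ℝ := fun i => Q i.1 i.2 / τ with hθ'
  have hπ' := softmaxPolicy_mem θ'
  have hV : ∀ s, M.softV τ g π s = ∑ a, π s a * (Q s a - τ * Real.log (π s a)) := M.softV_eq hπ τ g
  have hlse : ∀ s, ∑ a, softmaxPolicy θ' s a * (Q s a - τ * Real.log (softmaxPolicy θ' s a)) =
      τ * logSumExp fun a => Q s a / τ := fun s => sum_softmax_mul_sub_mul_log hτ (Q s)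
  have hnn : ∀ s ∈ Finset.univ, 0 ≤ M.occ (softmaxPolicy θ') M.μ s *
      ((τ * logSumExp fun a => Q s a / τ) - M.softV τ g π s) := fun s _ =>
    mul_nonneg (M.occ_nonneg hπ' M.μ_mem s)
      (sub_nonneg.2 (by rw [hV]; exact sum_mul_sub_mul_log_le hτ (Q s) (hπ s)))
  have h1 := h.learner θ'
  rw [utility_eq, utility_eq, ← hg, ← hπd, sub_le_sub_iff_right,
    M.discounted_eq_sum_single hπ M.μ_mem, ← sub_nonpos,
    M.discounted_sub_eq hπ' M.μ_mem] at h1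
  have h2 : ∑ s, M.occ (softmaxPolicy θ') M.μ s *
      ((τ * logSumExp fun a => Q s a / τ) - M.softV τ g π s) ≤ 0 := by
    refine le_of_eq_of_le (Finset.sum_congr rfl fun s _ => ?_) h1
    rw [← hlse]
    congr 1
    rw [softV]
    congr 1
    refine Finset.sum_congr rfl fun a _ => ?_
    simp only [hQ, softQScalar, softV]
    ring
  have h3 := (Finset.sum_eq_zero_iff_of_nonneg hnn).1
    (le_antisymm h2 (Finset.sum_nonneg hnn)) s (Finset.mem_univ s)
  have h4 := (mul_eq_zero.1 h3).resolve_left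
    (M.occ_pos hπ' (softmaxPolicy_pos θ') (hM s)).ne'
  refine eq_softmax_of_mul_logSumExp_le hτ (hπ s) ?_
  rw [← hV s]
  linarith

theorem isNash_of_isSoftOptimal [NeZero K] (hτ : 0 < τ) (hτw : 0 < τw) {Q : S → A → ℝ}
    {w : Fin K → ℝ} (hQ : M.IsSoftOptimal τ (M.scalarReward w) Q)
    (hw : w = softmax fun k => -M.value (softmaxPolicy fun i : S × A => Q i.1 i.2 / τ) k / τw) :
    M.IsNash τ τw (fun i => Q i.1 i.2 / τ) w where
  mem := by rw [hw]; exact softmax_mem _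
  learner θ' := by
    set θ : S × A → ℝ := fun i => Q i.1 i.2 / τ with hθ
    have hπ' := softmaxPolicy_mem θ'
    have hπ := softmaxPolicy_mem θ
    rw [utility_eq, utility_eq, sub_le_sub_iff_right, M.discounted_eq_sum_single hπ' M.μ_mem,
      M.discounted_eq_sum_single hπ M.μ_mem]
    refine Finset.sum_le_sum fun s _ => mul_le_mul_of_nonneg_left ?_ (M.μ_mem.1 s)
    have h1 := hQ.softV_le hτ hπ' (δ := 0) (fun s a => by rw [add_zero]) s
    rw [← hQ.softV_eq_of_softmax hτ (π := softmaxPolicy θ) (fun s => rfl) s, zero_div] at h1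
    exact sub_nonpos.1 h1
  adversary w' hw' := by
    have h1 := sum_mul_sub_log_le_logSumExp
      (fun k => -M.value (softmaxPolicy fun i : S × A => Q i.1 i.2 / τ) k / τw) hw'
    rw [← sum_softmax_mul_sub_log, ← hw] at h1
    rw [M.neg_utility_eq τ hτw, M.neg_utility_eq τ hτw]
    linarith [mul_le_mul_of_nonneg_left h1 hτw.le]

end Nash

end MOMDP

/-! ### Weak coupling, existence of equilibrium and error bounds. -/

namespace MOMDP

variable {S A : Type*} [Fintype S] [Fintype A] {K : ℕ} (M : MOMDP S A K)

/-- The Lipschitz constant of the adversary's best-response logits `-V / τ_w` with respect to the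
learner's logits scaled by `τ`. -/
noncomputable def couplingConst (τ τw : ℝ) : ℝ := ‖M.r‖ / (τ * τw * (1 - M.γ) ^ 2)

theorem couplingConst_nonneg {τ τw : ℝ} (hτ : 0 < τ) (hτw : 0 < τw) :
    0 ≤ M.couplingConst τ τw :=
  div_nonneg (norm_nonneg _) (mul_nonneg (mul_pos hτ hτw).le (sq_nonneg _))

variable [DecidableEq S]

/-- Error bounds for `(θ, w)` relative to `(Q⋆, ζ⋆)`, in terms of logits `ξ`, `ζ` of the policy and
of the weights: `x` bounds `|Q⋆ - τ ξ|`, `m` bounds `τ ξ - Q^{π_θ}_{w,τ}` and `q` bounds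
`|ζ - ζ⋆|`. -/
def ErrorBound (τ : ℝ) (Qs : S → A → ℝ) (ζs : Fin K → ℝ) (θ : S × A → ℝ) (w : Fin K → ℝ)
    (x m q : ℝ) : Prop :=
  ∃ (ξ : S × A → ℝ) (ζ : Fin K → ℝ), softmaxPolicy θ = softmaxPolicy ξ ∧ w = softmax ζ ∧
    (∀ s a, |Qs s a - τ * ξ (s, a)| ≤ x) ∧
    (∀ s a, τ * ξ (s, a) - M.softQ τ (softmaxPolicy θ) w s a ≤ m) ∧ ∀ k, |ζ k - ζs k| ≤ q

section

variable {M} {τ : ℝ} {Qs : S → A → ℝ} {ζs : Fin K → ℝ} {θ : S × A → ℝ} {w : Fin K → ℝ} {x m q : ℝ}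

theorem ErrorBound.mono (h : M.ErrorBound τ Qs ζs θ w x m q) {x' m' q' : ℝ}
    (hx : x ≤ x') (hm : m ≤ m') (hq : q ≤ q') : M.ErrorBound τ Qs ζs θ w x' m' q' := by
  obtain ⟨ξ, ζ, h1, h2, h3, h4, h5⟩ := h
  exact ⟨ξ, ζ, h1, h2, fun s a => (h3 s a).trans hx, fun s a => (h4 s a).trans hm,
    fun k => (h5 k).trans hq⟩

theorem ErrorBound.sum_abs_weight_sub_le [NeZero K] (h : M.ErrorBound τ Qs ζs θ w x m q) :
    ∑ k, |softmax ζs k - w k| ≤ q := by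
  obtain ⟨ξ, ζ, h1, rfl, h3, h4, h5⟩ := h
  exact sum_abs_softmax_sub_le fun k => by rw [abs_sub_comm]; exact h5 k

theorem ErrorBound.abs_log_policy_sub_le [Nonempty A] (hτ : 0 < τ)
    (h : M.ErrorBound τ Qs ζs θ w x m q)
    (s : S) (a : A) : |Real.log (softmax (fun a => Qs s a / τ) a) -
      Real.log (softmaxPolicy θ s a)| ≤ 2 / τ * x := by
  obtain ⟨ξ, ζ, h1, h2, h3, h4, h5⟩ := h
  rw [h1]
  refine (abs_log_softmax_sub_le (c := x / τ) (fun b => ?_) a).trans_eq (by ring)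
  rw [div_sub' hτ.ne', abs_div, abs_of_pos hτ]
  exact div_le_div_of_nonneg_right (h3 s b) hτ.le

end

variable [Nonempty A]

theorem abs_value_sub_le {ξ ξ' : S × A → ℝ} {c : ℝ} (h : ∀ s a, |ξ (s, a) - ξ' (s, a)| ≤ c)
    (k : Fin K) : |M.value (softmaxPolicy ξ) k - M.value (softmaxPolicy ξ') k| ≤
      c * ‖M.r‖ / (1 - M.γ) ^ 2 :=
  M.abs_discounted_sub_le (softmaxPolicy_mem ξ) (softmaxPolicy_mem ξ') M.μ_mem (norm_nonneg _)
    (fun s a => M.abs_r_le s a k) fun s => sum_abs_softmax_sub_le (h s)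

theorem abs_value_div_sub_le {τ τw : ℝ} (hτ : 0 < τ) (hτw : 0 < τw) {ξ ξ' : S × A → ℝ} {x : ℝ}
    (h : ∀ s a, |τ * ξ (s, a) - τ * ξ' (s, a)| ≤ x) (k : Fin K) :
    |M.value (softmaxPolicy ξ) k / τw - M.value (softmaxPolicy ξ') k / τw| ≤
      M.couplingConst τ τw * x := by
  have hγ := M.one_sub_γ_pos
  have h1 := M.abs_value_sub_le (ξ := ξ) (ξ' := ξ') (c := x / τ) (fun s a => by
    rw [le_div_iff₀ hτ]
    refine le_of_eq_of_le ?_ (h s a)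
    rw [← mul_sub, abs_mul, abs_of_pos hτ, mul_comm]) k
  rw [← sub_div, abs_div, abs_of_pos hτw, div_le_iff₀ hτw]
  refine h1.trans_eq ?_
  rw [couplingConst]
  field_simp

/-- A Nash equilibrium exists when the players are weakly coupled. -/
theorem exists_isNash [NeZero K] {τ τw : ℝ} (hτ : 0 < τ) (hτw : 0 < τw)
    (hc : ‖M.r‖ / (1 - M.γ) * M.couplingConst τ τw ≤ (1 - M.γ) / 12) :
    ∃ (θ : S × A → ℝ) (w : Fin K → ℝ), M.IsNash τ τw θ w := by
  have hγ := M.one_sub_γ_pos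
  have hγ0 := M.γ_pos
  have hκ := M.couplingConst_nonneg hτ hτw
  -- The weight logits are stored multiplied by `c`, which balances the cross terms: rewards
  -- contribute `‖r‖ / c` and the adversary's response `c` times the coupling constant. For nonzero
  -- rewards `c = 2‖r‖ / (1 - γ)` makes the first bound an equality.
  obtain ⟨c, hc0, hc1, hc2⟩ : ∃ c : ℝ, 0 < c ∧ ‖M.r‖ / c ≤ (1 - M.γ) / 2 ∧
      c * M.couplingConst τ τw ≤ 1 / 2 := by
    rcases (norm_nonneg M.r).eq_or_lt with h0 | h0
    · refine ⟨1, one_pos, ?_, ?_⟩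
      · rw [← h0, zero_div]; linarith
      · rw [couplingConst, ← h0]; norm_num
    · refine ⟨2 * (‖M.r‖ / (1 - M.γ)), by positivity, le_of_eq (by field_simp), ?_⟩
      rw [mul_assoc]
      linarith
  set Φ : (S → A → ℝ) × (Fin K → ℝ) → (S → A → ℝ) × (Fin K → ℝ) := fun p =>
    (fun s a => M.scalarReward (softmax fun k => p.2 k / c) s a +
        M.γ * ∑ s', M.P s a s' * (τ * logSumExp fun b => p.1 s' b / τ),
      fun k => c * (-M.value (softmaxPolicy fun i : S × A => p.1 i.1 i.2 / τ) k / τw)) with hΦ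
  -- The modulus is `γ` from the soft Bellman backup plus `(1 - γ) / 2` from the change of reward;
  -- the weight component contracts by `1/2`.
  have hL : 0 ≤ (1 + M.γ) / 2 := by linarith
  have hcon : ContractingWith (⟨(1 + M.γ) / 2, hL⟩ : NNReal) Φ := by
    refine ⟨?_, LipschitzWith.of_dist_le_mul fun p p' => ?_⟩
    · have : (1 + M.γ) / 2 < 1 := by linarith
      exact_mod_cast this
    set D := dist p p' with hD
    have hD0 : 0 ≤ D := dist_nonneg
    have hp1 : ∀ s a, |p.1 s a - p'.1 s a| ≤ D := fun s a => by
      rw [← Real.dist_eq]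
      exact ((dist_le_pi_dist _ _ a).trans (dist_le_pi_dist p.1 p'.1 s)).trans (le_max_left _ _)
    have hp2 : ∀ k, |p.2 k - p'.2 k| ≤ D := fun k => by
      rw [← Real.dist_eq]
      exact (dist_le_pi_dist p.2 p'.2 k).trans (le_max_right _ _)
    change dist (Φ p) (Φ p') ≤ (1 + M.γ) / 2 * D
    have hLD : 0 ≤ (1 + M.γ) / 2 * D := mul_nonneg hL hD0
    refine max_le ((dist_pi_le_iff hLD).2 fun s => (dist_pi_le_iff hLD).2 fun a => ?_)
      ((dist_pi_le_iff hLD).2 fun k => ?_)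
    · have hlse : ∀ s', |(τ * logSumExp fun b => p.1 s' b / τ) -
          (τ * logSumExp fun b => p'.1 s' b / τ)| ≤ D := by
        intro s'
        rw [← mul_sub, abs_mul, abs_of_pos hτ, ← le_div_iff₀' hτ]
        refine abs_logSumExp_sub_le fun b => ?_
        rw [← sub_div, abs_div, abs_of_pos hτ]
        exact div_le_div_of_nonneg_right (hp1 s' b) hτ.le
      have h1 : |∑ s', M.P s a s' * ((τ * logSumExp fun b => p.1 s' b / τ) -
          (τ * logSumExp fun b => p'.1 s' b / τ))| ≤ D :=
        abs_sum_mul_le_of_mem_stdSimplex (M.P_mem s a) hlse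
      have h2 : ∑ k, |softmax (fun k => p.2 k / c) k - softmax (fun k => p'.2 k / c) k| ≤ D / c :=
        sum_abs_softmax_sub_le fun k => by
          rw [← sub_div, abs_div, abs_of_pos hc0]
          exact div_le_div_of_nonneg_right (hp2 k) hc0.le
      have h3 := M.abs_scalarReward_sub_le (softmax fun k => p.2 k / c)
        (softmax fun k => p'.2 k / c) s a
      have h4 : ‖M.r‖ * (D / c) ≤ (1 - M.γ) / 2 * D := by
        calc _ = ‖M.r‖ / c * D := by ring
          _ ≤ _ := mul_le_mul_of_nonneg_right hc1 hD0
      have h5 := mul_le_mul_of_nonneg_left h2 (norm_nonneg M.r)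
      simp_rw [mul_sub, Finset.sum_sub_distrib] at h1
      rw [Real.dist_eq, hΦ]
      calc _ = |(M.scalarReward (softmax fun k => p.2 k / c) s a -
              M.scalarReward (softmax fun k => p'.2 k / c) s a) +
            M.γ * (∑ s', M.P s a s' * (τ * logSumExp fun b => p.1 s' b / τ) -
              ∑ s', M.P s a s' * (τ * logSumExp fun b => p'.1 s' b / τ))| := by
            congr 1; ring
        _ ≤ (1 - M.γ) / 2 * D + M.γ * D := by
            refine (abs_add_le _ _).trans (add_le_add (h3.trans (h5.trans h4)) ?_)
            rw [abs_mul, abs_of_pos hγ0]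
            exact mul_le_mul_of_nonneg_left h1 hγ0.le
        _ = (1 + M.γ) / 2 * D := by ring
    · have h1 := M.abs_value_div_sub_le hτ hτw (x := D)
        (ξ := fun i => p.1 i.1 i.2 / τ) (ξ' := fun i => p'.1 i.1 i.2 / τ) (fun s a => by
          rw [mul_div_cancel₀ _ hτ.ne', mul_div_cancel₀ _ hτ.ne']
          exact hp1 s a) k
      rw [Real.dist_eq, hΦ]
      dsimp only
      rw [← mul_sub, abs_mul, abs_of_pos hc0, neg_div, neg_div, neg_sub_neg, abs_sub_comm]
      have h2 := mul_le_mul_of_nonneg_left h1 hc0.le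
      have h3 := mul_le_mul_of_nonneg_right hc2 hD0
      have h4 : 0 ≤ M.γ * D := mul_nonneg hγ0.le hD0
      linarith
  set p := ContractingWith.fixedPoint Φ hcon
  have hp : Φ p = p := hcon.fixedPoint_isFixedPt
  refine ⟨_, softmax fun k => p.2 k / c, isNash_of_isSoftOptimal (Q := p.1) hτ hτw
    (fun s a => (congrFun (congrFun (congrArg Prod.fst hp) s) a).symm) ?_⟩
  congr 1
  funext k
  rw [div_eq_iff hc0.ne', mul_comm]
  exact (congrFun (congrArg Prod.snd hp) k).symm

/-! ### One step of ERAM -/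

variable {M} [NeZero K]

section

variable {τ : ℝ} {Qs : S → A → ℝ} {ζs : Fin K → ℝ} {θ : S × A → ℝ} {w : Fin K → ℝ} {x m q : ℝ}

/-- From above, the logit comparison gives `γ (x + m)`; from below, optimality of `Qs` leaves only
the reward perturbation, at most `‖r‖ q` because softmax is 1-Lipschitz into `ℓ¹`. -/
theorem ErrorBound.abs_sub_softQ_le (hτ : 0 < τ)
    (hQs : M.IsSoftOptimal τ (M.scalarReward (softmax ζs)) Qs)
    (h : M.ErrorBound τ Qs ζs θ w x m q) (hm0 : 0 ≤ m) (s : S) (a : A) :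
    |Qs s a - M.softQ τ (softmaxPolicy θ) w s a| ≤
      M.γ * (x + m) + ‖M.r‖ / (1 - M.γ) * q := by
  have hγ := M.one_sub_γ_pos
  have hγ0 := M.γ_pos
  have hw := h.sum_abs_weight_sub_le
  have hq0 : 0 ≤ q := (Finset.sum_nonneg fun k _ => abs_nonneg _).trans hw
  have hRq : 0 ≤ ‖M.r‖ * q := mul_nonneg (norm_nonneg _) hq0
  have hg : ∀ s a, |M.scalarReward (softmax ζs) s a - M.scalarReward w s a| ≤ ‖M.r‖ * q :=
    fun s a => (M.abs_scalarReward_sub_le _ _ s a).trans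
      (mul_le_mul_of_nonneg_left hw (norm_nonneg _))
  obtain ⟨ξ, ζ, h1, rfl, h3, h4, h5⟩ := h
  have hx0 : 0 ≤ x := (abs_nonneg _).trans (h3 s a)
  rw [h1, M.softQ_eq (softmaxPolicy_mem ξ) (sum_softmax ζ)] at h4 ⊢
  have hu := hQs.sub_softQScalar_le hτ (g := M.scalarReward (softmax ζ)) (δ := ‖M.r‖ * q)
    (fun s a => by linarith [(abs_le.1 (hg s a)).2]) (fun s a => (le_abs_self _).trans (h3 s a))
    h4 s a
  have hl := hQs.softQScalar_sub_le hτ (g := M.scalarReward (softmax ζ)) (δ := ‖M.r‖ * q)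
    (softmaxPolicy_mem ξ) (fun s a => by linarith [(abs_le.1 (hg s a)).1]) s a
  have h6 : ‖M.r‖ * q ≤ ‖M.r‖ * q / (1 - M.γ) := le_div_self hRq hγ (by linarith)
  have h7 : 0 ≤ M.γ * (x + m) := mul_nonneg hγ0.le (add_nonneg hx0 hm0)
  rw [div_mul_eq_mul_div, abs_le]
  constructor <;> linarith

/-- One step of ERAM contracts the error bounds. -/
theorem ErrorBound.step [DecidableEq A] (hM : ∀ s, M.Reachable s) {τw ε η lam : ℝ} (hτ : 0 < τ)
    (hτw : 0 < τw) (hε : 0 < ε) (hε1 : ε < 1) (hη : η = ε * (1 - M.γ) / τ)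
    (hlam : lam = ε ^ 2 / (τw * (1 - ε ^ 2)))
    (hQs : M.IsSoftOptimal τ (M.scalarReward (softmax ζs)) Qs)
    (hζs : ∀ k, ζs k = -M.value (softmaxPolicy fun i : S × A => Qs i.1 i.2 / τ) k / τw)
    (h : M.ErrorBound τ Qs ζs θ w x m q) (hm0 : 0 ≤ m) :
    M.ErrorBound τ Qs ζs (M.npgStep η τ θ w) (M.weightStep lam τw θ w)
      ((1 - ε) * x + ε * (M.γ * (x + m) + ‖M.r‖ / (1 - M.γ) * q))
      ((1 - ε) * m + ‖M.r‖ / (1 - M.γ) * (ε ^ 2 * (q + M.couplingConst τ τw * x)))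
      ((1 - ε ^ 2) * q + ε ^ 2 * (M.couplingConst τ τw * x)) := by
  have hγ := M.one_sub_γ_pos
  have hε2 : 0 < 1 - ε ^ 2 := by nlinarith
  have hy := h.abs_sub_softQ_le hτ hQs hm0
  obtain ⟨ξ, ζ, h1, rfl, h3, h4, h5⟩ := h
  set κ := M.couplingConst τ τw
  set Q := M.softQ τ (softmaxPolicy θ) (softmax ζ) with hQ
  have hQ' : Q = M.softQScalar τ (M.scalarReward (softmax ζ)) (softmaxPolicy ξ) := by
    rw [hQ, h1, M.softQ_eq (softmaxPolicy_mem ξ) (sum_softmax ζ)]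
  set ξ' : S × A → ℝ := fun i => (1 - ε) * ξ i + ε * (Q i.1 i.2 / τ) with hξ'
  set v : Fin K → ℝ := fun k => M.value (softmaxPolicy θ) k / τw with hv
  set ζ' : Fin K → ℝ := fun k => (1 - ε ^ 2) * ζ k - ε ^ 2 * v k with hζ'
  have hvb : ∀ k, |ζs k + v k| ≤ κ * x := by
    intro k
    have := M.abs_value_div_sub_le hτ hτw (ξ := ξ) (ξ' := fun i => Qs i.1 i.2 / τ) (x := x)
      (fun s a => by
        rw [mul_div_cancel₀ _ hτ.ne', abs_sub_comm]
        exact h3 s a) k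
    rw [hζs, hv, h1, neg_div, neg_add_eq_sub]
    exact this
  have hpol : softmaxPolicy (M.npgStep η τ θ (softmax ζ)) = softmaxPolicy ξ' := by
    obtain ⟨c, hc⟩ := M.exists_npgStep_eq hM η τ θ (sum_softmax ζ)
    funext s
    have hl : ∀ a, θ (s, a) - logSumExp (fun a => θ (s, a)) =
        ξ (s, a) - logSumExp (fun a => ξ (s, a)) := fun a => by
      have := congrFun (congrFun h1 s) a
      simp only [softmaxPolicy] at this
      rw [← log_softmax (fun a => θ (s, a)), ← log_softmax (fun a => ξ (s, a)), this]
    -- The constant collects the offset between `θ` and `ξ`, damped by `1 - ε`, the normalizer of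
    -- `log π_θ` with weight `ε`, and the kernel component `c s`.
    refine softmax_eq_of_sub_const ((1 - ε) * (logSumExp (fun a => θ (s, a)) -
      logSumExp (fun a => ξ (s, a))) + ε * logSumExp (fun a => θ (s, a)) + c s) fun a => ?_
    have e : η / (1 - M.γ) = ε / τ := by rw [hη]; field_simp
    rw [hc, e, hξ', softmaxPolicy, log_softmax]
    have hθ : θ (s, a) = ξ (s, a) + (logSumExp (fun a => θ (s, a)) -
      logSumExp (fun a => ξ (s, a))) := by linarith [hl a]
    have e2 : ε / τ * (Q s a - τ * (θ (s, a) - logSumExp fun a => θ (s, a))) =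
        ε * (Q s a / τ) - ε * (θ (s, a) - logSumExp fun a => θ (s, a)) := by field_simp
    change _ + ε / τ * (Q s a - _) + _ = _
    rw [e2]
    linear_combination (1 - ε) * hθ
  have hwt : M.weightStep lam τw θ (softmax ζ) = softmax ζ' := by
    -- The choice of `lam` is the one that makes `β = 1 - ε²`.
    have e : 1 / (lam * τw + 1) = 1 - ε ^ 2 := by
      rw [hlam]
      field_simp
      ring
    simp only [weightStep, e]
    refine softmax_eq_of_sub_const (-(1 - ε ^ 2) * logSumExp ζ) fun k => ?_
    rw [log_softmax, hζ', hv]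
    ring
  have hdw : ∀ k, |ζ k - ζ' k| ≤ ε ^ 2 * (q + κ * x) := by
    intro k
    have e : ζ k - ζ' k = ε ^ 2 * ((ζ k - ζs k) + (ζs k + v k)) := by rw [hζ']; ring
    rw [e, abs_mul, abs_of_pos (pow_pos hε 2)]
    exact mul_le_mul_of_nonneg_left ((abs_add_le _ _).trans (add_le_add (h5 k) (hvb k)))
      (pow_pos hε 2).le
  refine ⟨ξ', ζ', hpol, hwt, fun s a => ?_, fun s a => ?_, fun k => ?_⟩
  · have e : Qs s a - τ * ξ' (s, a) =
        (1 - ε) * (Qs s a - τ * ξ (s, a)) + ε * (Qs s a - Q s a) := by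
      rw [hξ']; field_simp; ring
    rw [e]
    refine (abs_add_le _ _).trans (add_le_add ?_ ?_)
    · rw [abs_mul, abs_of_pos (by linarith : 0 < 1 - ε)]
      exact mul_le_mul_of_nonneg_left (h3 s a) (by linarith)
    · rw [abs_mul, abs_of_pos hε]
      exact mul_le_mul_of_nonneg_left (hy s a) hε.le
  -- Split `τ ξ' - Q'` as `(1 - ε)(τ ξ - Q) + (Q - Q')`. Policy improvement bounds the last term by
  -- the effect of the weight update alone, of order `ε²`.
  · have hδ : ∀ s a, M.scalarReward (softmax ζ) s a ≤ M.scalarReward (softmax ζ') s a +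
        ‖M.r‖ * (ε ^ 2 * (q + κ * x)) := fun s a => by
      have := (le_abs_self _).trans ((M.abs_scalarReward_sub_le (softmax ζ) (softmax ζ') s a).trans
        (mul_le_mul_of_nonneg_left (sum_abs_softmax_sub_le hdw) (norm_nonneg _)))
      linarith
    have himp := softQScalar_sub_le_of_interpolation hτ hε hε1.le hδ
      (ξ := ξ) (ξ' := ξ') (fun s a => by rw [hξ', hQ']) s a
    rw [hpol, hwt, M.softQ_eq (softmaxPolicy_mem ξ') (sum_softmax ζ')]
    rw [← hQ'] at himp
    have e : τ * ξ' (s, a) = (1 - ε) * (τ * ξ (s, a) - Q s a) + Q s a := by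
      rw [hξ']; field_simp; ring
    have h6 := mul_le_mul_of_nonneg_left (h4 s a) (by linarith : 0 ≤ 1 - ε)
    rw [e, div_mul_eq_mul_div]
    linarith
  · have e : ζ' k - ζs k = (1 - ε ^ 2) * (ζ k - ζs k) - ε ^ 2 * (ζs k + v k) := by rw [hζ']; ring
    rw [e]
    refine (abs_sub _ _).trans (add_le_add ?_ ?_)
    · rw [abs_mul, abs_of_pos hε2]
      exact mul_le_mul_of_nonneg_left (h5 k) hε2.le
    · rw [abs_mul, abs_of_pos (pow_pos hε 2)]
      exact mul_le_mul_of_nonneg_left (hvb k) (pow_pos hε 2).le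

end

/-- Geometric decay of the error bounds along ERAM. -/
theorem exists_errorBound_eram [DecidableEq A] (hM : ∀ s, M.Reachable s) {τ τw ε η lam : ℝ}
    (hτ : 0 < τ) (hτw : 0 < τw)
    (hc : ‖M.r‖ / (1 - M.γ) * M.couplingConst τ τw ≤ (1 - M.γ) / 12) (hε : 0 < ε)
    (hε1 : ε < (1 - M.γ) / 2) (hη : η = ε * (1 - M.γ) / τ)
    (hlam : lam = ε ^ 2 / (τw * (1 - ε ^ 2))) {Qs : S → A → ℝ} {ζs : Fin K → ℝ}
    (hQs : M.IsSoftOptimal τ (M.scalarReward (softmax ζs)) Qs)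
    (hζs : ∀ k, ζs k = -M.value (softmaxPolicy fun i : S × A => Qs i.1 i.2 / τ) k / τw)
    (θ₀ : S × A → ℝ) {w₀ : Fin K → ℝ} (hw₀ : ∑ k, w₀ k = 1) (hpos : ∀ k, 0 < w₀ k) :
    ∃ X Y Z : ℝ, 0 ≤ Y ∧ ∀ t : ℕ, M.ErrorBound τ Qs ζs (M.eram η lam τ τw θ₀ w₀ t).1
      (M.eram η lam τ τw θ₀ w₀ t).2 (X * (1 - ε ^ 2 / 2) ^ t) (Y * (1 - ε ^ 2 / 2) ^ t)
      (Z * (1 - ε ^ 2 / 2) ^ t) := by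
  have hγ := M.one_sub_γ_pos
  have hγ0 := M.γ_pos
  have hκ := M.couplingConst_nonneg hτ hτw
  set κ := M.couplingConst τ τw
  set R := ‖M.r‖ / (1 - M.γ) with hR
  have hR0 : 0 ≤ R := div_nonneg (norm_nonneg _) hγ.le
  set x₀ := ‖fun s a => Qs s a - τ * θ₀ (s, a)‖ with hx₀
  set m₀ := ‖fun s a => τ * θ₀ (s, a) - M.softQ τ (softmaxPolicy θ₀) w₀ s a‖ with hm₀
  set q₀ := ‖fun k => Real.log (w₀ k) - ζs k‖ with hq₀
  have hx₀0 : 0 ≤ x₀ := norm_nonneg _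
  have hm₀0 : 0 ≤ m₀ := norm_nonneg _
  have hq₀0 : 0 ≤ q₀ := norm_nonneg _
  have hinit : M.ErrorBound τ Qs ζs θ₀ w₀ x₀ m₀ q₀ := by
    refine ⟨θ₀, fun k => Real.log (w₀ k), rfl, (softmax_log hpos hw₀).symm, fun s a => ?_,
      fun s a => ?_, fun k => ?_⟩
    · exact (norm_le_pi_norm (fun a => Qs s a - τ * θ₀ (s, a)) a).trans
        (norm_le_pi_norm (fun s a => Qs s a - τ * θ₀ (s, a)) s)
    · exact (le_abs_self _).trans
        ((norm_le_pi_norm (fun a => τ * θ₀ (s, a) - M.softQ τ (softmaxPolicy θ₀) w₀ s a) a).trans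
        (norm_le_pi_norm (fun s a => τ * θ₀ (s, a) - M.softQ τ (softmaxPolicy θ₀) w₀ s a) s))
    · exact norm_le_pi_norm (fun k => Real.log (w₀ k) - ζs k) k
  -- The coefficients 12 and 4 make `R q₀ ≤ (1 - γ) X / 12` and `m₀ ≤ (1 - γ) X / 4 = Y`.
  set X := x₀ + 12 / (1 - M.γ) * (R * q₀) + 4 / (1 - M.γ) * m₀ with hX
  have hRq : 0 ≤ R * q₀ := mul_nonneg hR0 hq₀0
  have hXx : x₀ ≤ X := by
    have : 0 ≤ 12 / (1 - M.γ) * (R * q₀) := by positivity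
    have : 0 ≤ 4 / (1 - M.γ) * m₀ := by positivity
    linarith
  have hX0 : 0 ≤ X := hx₀0.trans hXx
  have hXe : (1 - M.γ) * X = (1 - M.γ) * x₀ + 12 * (R * q₀) + 4 * m₀ := by
    rw [hX]; field_simp
  have hgx : 0 ≤ (1 - M.γ) * x₀ := mul_nonneg hγ.le hx₀0
  set Y := (1 - M.γ) * X / 4 with hY
  have hY0 : 0 ≤ Y := by positivity
  -- The factor 2 makes `κ X ≤ Z / 2`, so the forcing of the weights uses half of their contraction
  -- `ε²` and leaves the rate `1 - ε²/2`.
  set Z := 2 * (κ * X) + q₀ with hZ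
  have hκX : 0 ≤ κ * X := mul_nonneg hκ hX0
  have hRκX : R * (κ * X) ≤ (1 - M.γ) * X / 12 := by
    calc _ = R * κ * X := by ring
      _ ≤ (1 - M.γ) / 12 * X := mul_le_mul_of_nonneg_right hc hX0
      _ = _ := by ring
  -- The three twelfths: `R κ ≤ (1 - γ) / 12` counted twice, plus the share of `R q₀`.
  have hRZ : R * Z ≤ (1 - M.γ) * X / 4 := by
    have : R * Z = 2 * (R * (κ * X)) + R * q₀ := by rw [hZ]; ring
    linarith
  refine ⟨X, Y, Z, hY0, fun t => ?_⟩
  have hρ : 0 ≤ 1 - ε ^ 2 / 2 := by nlinarith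
  induction t with
  | zero =>
    simp only [pow_zero, mul_one]
    exact hinit.mono hXx (by linarith) (by linarith)
  | succ t ih =>
    have hs := ih.step hM hτ hτw hε (by linarith) hη hlam hQs hζs
      (mul_nonneg hY0 (pow_nonneg hρ t))
    set p := (1 - ε ^ 2 / 2) ^ t
    have hp : 0 ≤ p := pow_nonneg hρ t
    refine hs.mono ?_ ?_ ?_
    -- Both `Y` and `R Z` are at most a quarter of `(1 - γ) X`; the remaining half covers `ε X / 2`
    -- because `ε < (1 - γ) / 2`.
    · have h1 : (1 - ε) * X + ε * (M.γ * (X + Y) + R * Z) ≤ X * (1 - ε ^ 2 / 2) := by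
        have h2 : M.γ * Y ≤ Y := mul_le_of_le_one_left hY0 M.γ_lt_one.le
        have h3 : ε / 2 * X ≤ (1 - M.γ) / 4 * X := mul_le_mul_of_nonneg_right (by linarith) hX0
        have h4 : M.γ * Y + R * Z ≤ (1 - M.γ) * X - ε / 2 * X := by
          have : 0 ≤ (1 - M.γ) * X := mul_nonneg hγ.le hX0
          linarith
        have h5 := mul_le_mul_of_nonneg_left h4 hε.le
        linarith
      calc _ = ((1 - ε) * X + ε * (M.γ * (X + Y) + R * Z)) * p := by ring
        _ ≤ X * (1 - ε ^ 2 / 2) * p := mul_le_mul_of_nonneg_right h1 hp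
        _ = _ := by rw [pow_succ]; ring
    -- The weight drift has size `ε² · (4/3) Y` against a decay `ε Y`; `ε ≤ 1/2` leaves room for the
    -- rate.
    · have h1 : (1 - ε) * Y + R * (ε ^ 2 * (Z + κ * X)) ≤ Y * (1 - ε ^ 2 / 2) := by
        have h2 : R * Z + R * (κ * X) ≤ 4 / 3 * Y := by rw [hY]; linarith
        have h3 : ε * (R * Z + R * (κ * X)) ≤ ε * (4 / 3 * Y) :=
          mul_le_mul_of_nonneg_left h2 hε.le
        have h4 : ε * Y ≤ 1 / 2 * Y := mul_le_mul_of_nonneg_right (by linarith) hY0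
        have h5 : ε * (R * Z + R * (κ * X)) ≤ Y - ε / 2 * Y := by linarith
        have h6 := mul_le_mul_of_nonneg_left h5 hε.le
        linarith
      calc _ = ((1 - ε) * Y + R * (ε ^ 2 * (Z + κ * X))) * p := by ring
        _ ≤ Y * (1 - ε ^ 2 / 2) * p := mul_le_mul_of_nonneg_right h1 hp
        _ = _ := by rw [pow_succ]; ring
    · have h1 : (1 - ε ^ 2) * Z + ε ^ 2 * (κ * X) ≤ Z * (1 - ε ^ 2 / 2) := by
        have h2 : κ * X ≤ Z / 2 := by rw [hZ]; linarith
        have h3 := mul_le_mul_of_nonneg_left h2 (sq_nonneg ε)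
        linarith
      calc _ = ((1 - ε ^ 2) * Z + ε ^ 2 * (κ * X)) * p := by ring
        _ ≤ Z * (1 - ε ^ 2 / 2) * p := mul_le_mul_of_nonneg_right h1 hp
        _ = _ := by rw [pow_succ]; ring

end MOMDP

/-! ### Assembly of the theorem. -/

theorem norm_le_of_abs_le {S A : Type*} [Fintype S] [Fintype A] [Nonempty S] [Nonempty A]
    {f : S → A → ℝ} {b : ℝ} (h : ∀ s a, |f s a| ≤ b) : ‖f‖ ≤ b :=
  (pi_norm_le_iff_of_nonempty f).2 fun s => (pi_norm_le_iff_of_nonempty (f s)).2 (h s)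

/- Norms of functions on finite types are sup norms: `‖M.r‖ = max_{s,a,k} |r_k(s,a)|`. -/
theorem mainTheorem2 (γ : ℝ) (hγ₀ : 0 < γ) (hγ₁ : γ < 1) :
    ∃ ε₀ : ℝ, 0 < ε₀ ∧ ε₀ ≤ 1 ∧
      ∀ (S A : Type*) [Fintype S] [DecidableEq S] [Fintype A] [DecidableEq A] [Nonempty A]
        (K : ℕ) [NeZero K] (M : MOMDP S A K), M.γ = γ → (∀ s, M.Reachable s) →
      ∀ τ τw : ℝ, 0 < τ → 0 < τw →
        12 * K * (‖M.r‖ + τ * Real.log (Fintype.card A)) ^ 2 / (τ * (1 - γ) ^ 4) ≤ τw →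
      (∃ (θs : S × A → ℝ) (ws : Fin K → ℝ), M.IsNash τ τw θs ws) ∧
      ∀ ε : ℝ, 0 < ε → ε < ε₀ →
      ∀ η lam : ℝ, η = ε * (1 - γ) / τ → lam = ε ^ 2 / (τw * (1 - ε ^ 2)) →
      ∃ ρ : ℝ, 0 < ρ ∧ ρ ≤ 1 - ε ^ 2 / 2 ∧
        ∀ (θs : S × A → ℝ) (ws : Fin K → ℝ), M.IsNash τ τw θs ws →
        ∀ (θ₀ : S × A → ℝ) (w₀ : Fin K → ℝ), w₀ ∈ stdSimplex ℝ (Fin K) → (∀ k, 0 < w₀ k) →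
        ∃ C₁ C₂ C₃ : ℝ, ∀ t : ℕ,
          ‖fun s a => Real.log (softmaxPolicy θs s a)
              - Real.log (softmaxPolicy (M.eram η lam τ τw θ₀ w₀ t).1 s a)‖ ≤ C₁ * ρ ^ t ∧
          ‖ws - (M.eram η lam τ τw θ₀ w₀ t).2‖ ≤ C₂ * ρ ^ t ∧
          ‖M.softQ τ (softmaxPolicy θs) ws
              - M.softQ τ (softmaxPolicy (M.eram η lam τ τw θ₀ w₀ t).1)
                  (M.eram η lam τ τw θ₀ w₀ t).2‖ ≤ C₃ * ρ ^ t := by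
  have hγ : 0 < 1 - γ := sub_pos.2 hγ₁
  refine ⟨(1 - γ) / 2, by linarith, by linarith, ?_⟩
  intro S A _ _ _ _ _ K _ M hMγ hM τ τw hτ hτw hcond
  -- Cleared of denominators, this is `12 ‖r‖² ≤ τ τ_w (1 - γ)⁴`, which the bound on `τ_w` implies
  -- since `K ≥ 1` and `τ log |A| ≥ 0`.
  have hcoup : ‖M.r‖ / (1 - M.γ) * M.couplingConst τ τw ≤ (1 - M.γ) / 12 := by
    have hK : (1 : ℝ) ≤ K := by exact_mod_cast NeZero.one_le
    have hR : 0 ≤ ‖M.r‖ := norm_nonneg _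
    have hlog : 0 ≤ τ * Real.log (Fintype.card A) :=
      mul_nonneg hτ.le (Real.log_natCast_nonneg _)
    rw [div_le_iff₀ (by positivity)] at hcond
    have h1 : ‖M.r‖ ^ 2 ≤ (‖M.r‖ + τ * Real.log (Fintype.card A)) ^ 2 :=
      pow_le_pow_left₀ hR (by linarith) 2
    have h2 : 12 * ‖M.r‖ ^ 2 ≤ 12 * K * (‖M.r‖ + τ * Real.log (Fintype.card A)) ^ 2 :=
      mul_le_mul (by linarith) h1 (sq_nonneg _) (by linarith)
    rw [hMγ, MOMDP.couplingConst, hMγ, div_mul_div_comm,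
      div_le_div_iff₀ (by positivity) (by norm_num)]
    calc _ = 12 * ‖M.r‖ ^ 2 := by ring
      _ ≤ _ := h2.trans hcond
      _ = _ := by ring
  refine ⟨M.exists_isNash hτ hτw hcoup, ?_⟩
  intro ε hε hε1 η lam hη hlam
  have hρ : 0 < 1 - ε ^ 2 / 2 := by nlinarith
  refine ⟨1 - ε ^ 2 / 2, hρ, le_rfl, ?_⟩
  intro θs ws hN θ₀ w₀ hw₀ hpos
  subst hMγ
  obtain ⟨s₀⟩ : Nonempty S := by
    by_contra h
    rw [not_nonempty_iff] at h
    have := M.μ_mem.2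
    simp at this
  have : Nonempty S := ⟨s₀⟩
  -- The target is read off from the given equilibrium, so its uniqueness plays no role.
  set Qs := M.softQScalar τ (M.scalarReward ws) (softmaxPolicy θs) with hQd
  set ζs : Fin K → ℝ := fun k => -M.value (softmaxPolicy θs) k / τw with hζd
  have hws : ws = softmax ζs := hN.weight_eq hτw
  have hπs : ∀ s, softmaxPolicy θs s = softmax fun a => Qs s a / τ := hN.policy_eq hM hτ
  have hQs : M.IsSoftOptimal τ (M.scalarReward (softmax ζs)) Qs := by
    rw [← hws]
    exact MOMDP.isSoftOptimal_of_softmax hτ hπs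
  have hζs : ∀ k, ζs k = -M.value (softmaxPolicy fun i : S × A => Qs i.1 i.2 / τ) k / τw := by
    have : softmaxPolicy (fun i : S × A => Qs i.1 i.2 / τ) = softmaxPolicy θs :=
      funext fun s => (hπs s).symm
    intro k
    rw [this]
  obtain ⟨X, Y, Z, hY, hE⟩ := MOMDP.exists_errorBound_eram hM hτ hτw hcoup hε hε1 hη hlam hQs
    hζs θ₀ hw₀.2 hpos
  refine ⟨2 / τ * X, Z, M.γ * (X + Y) + ‖M.r‖ / (1 - M.γ) * Z, fun t => ?_⟩
  have hp : 0 ≤ (1 - ε ^ 2 / 2) ^ t := pow_nonneg hρ.le t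
  refine ⟨norm_le_of_abs_le fun s a => ?_, (pi_norm_le_iff_of_nonempty _).2 fun k => ?_,
    norm_le_of_abs_le fun s a => ?_⟩
  · rw [hπs s, mul_assoc]
    exact (hE t).abs_log_policy_sub_le hτ s a
  · rw [Pi.sub_apply, hws, Real.norm_eq_abs]
    exact (Finset.single_le_sum (f := fun k => |softmax ζs k - _|) (fun _ _ => abs_nonneg _)
      (Finset.mem_univ k)).trans (hE t).sum_abs_weight_sub_le
  · have h := (hE t).abs_sub_softQ_le hτ hQs (mul_nonneg hY hp) s a
    rw [Pi.sub_apply, Pi.sub_apply, M.softQ_eq (softmaxPolicy_mem θs) hN.mem.2, ← hQd]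
    exact h.trans_eq (by ring)
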